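/- Let $\mathbb{HP}^1$ be the left quaternionic projective line, identified with $S^4$, and let $\pi:\mathbb{CP}^3\to\mathbb{HP}^1\simeq S^4$, $\pi[z_0,z_1,z_2,z_3]=[z_0+z_1j,\;z_2+z_3j]$, be the twistor fibration; its fibres are called twistor lines. Let $d\ge 1$ and let $X=\{f=0\}\subset\mathbb{CP}^3$ be any surface of degree $d$, where $f\in\mathbb{C}[z_0,z_1,z_2,z_3]$ is a nonzero homogeneous polynomial of degree $d$ (not necessarily irreducible or square-free). Its twistor discriminant locus is $$\mathrm{Disc}(X)=\{q\in S^4 : |\pi^{-1}(q)\cap X|\neq d\},$$ where $\pi^{-1}(q)\cap X$ is taken as a set of points. Then $\mathrm{Disc}(X)$ is a finite set if and only if either $d=1$, or $d>1$ and $X$ is the union of $d$ distinct planes $H_1,\dots,H_d$ all containing the same twistor line $L$. In all these cases $\mathrm{Disc}(X)$ is a single point. -/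

import Mathlib

open scoped Quaternion LinearAlgebra.Projectivization

namespace Twistor

/-- The complex projective space `ℂℙ³`. -/
abbrev CP3 : Type := ℙ ℂ (Fin 4 → ℂ)

/-- The left quaternionic projective line `ℍℙ¹` (nonzero vectors of `ℍ²` modulo left multiplication
by nonzero quaternions), which is the standard model of the sphere `S⁴ = ℍ ∪ {∞}` here. -/
abbrev HP1 : Type := ℙ ℍ[ℝ] (Fin 2 → ℍ[ℝ])

/-- The quaternionic unit `j`. -/
def quatJ : ℍ[ℝ] := ⟨0, 0, 1, 0⟩

/-- The identification `ℂ⁴ → ℍ²`, `(z₀, z₁, z₂, z₃) ↦ (z₀ + z₁ j, z₂ + z₃ j)`. -/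
noncomputable def toQuat (z : Fin 4 → ℂ) : Fin 2 → ℍ[ℝ] :=
  ![(z 0 : ℍ[ℝ]) + (z 1 : ℍ[ℝ]) * quatJ, (z 2 : ℍ[ℝ]) + (z 3 : ℍ[ℝ]) * quatJ]

theorem toQuat_smul (t : ℂ) (z : Fin 4 → ℂ) : toQuat (t • z) = (t : ℍ[ℝ]) • toQuat z := by
  funext i
  fin_cases i <;> simp [toQuat, mul_add, mul_assoc]

theorem toQuat_ne_zero {z : Fin 4 → ℂ} (hz : z ≠ 0) : toQuat z ≠ 0 := by
  intro h
  apply hz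
  have h0 := congrFun h 0
  have h1 := congrFun h 1
  have hJ : quatJ.re = 0 ∧ quatJ.imI = 0 ∧ quatJ.imJ = 1 ∧ quatJ.imK = 0 := ⟨rfl, rfl, rfl, rfl⟩
  simp [toQuat, hJ, Quaternion.ext_iff, Quaternion.re_mul, Quaternion.imI_mul,
    Quaternion.imJ_mul, Quaternion.imK_mul] at h0 h1
  funext i
  fin_cases i <;> apply Complex.ext <;> simp [h0, h1]

/-- The twistor fibration `π : ℂℙ³ → ℍℙ¹ ≃ S⁴`,
`π [z₀, z₁, z₂, z₃] = [z₀ + z₁ j, z₂ + z₃ j]`. -/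
noncomputable def twistorProj : CP3 → HP1 :=
  Projectivization.lift
    (fun z => Projectivization.mk ℍ[ℝ] (toQuat z.1) (toQuat_ne_zero z.2))
    (by
      rintro ⟨a, ha⟩ ⟨b, hb⟩ t h
      rw [Projectivization.mk_eq_mk_iff']
      exact ⟨(t : ℍ[ℝ]), (toQuat_smul t b).symm.trans (congrArg toQuat h.symm)⟩)

/-- Twistor lines are the fibres of `π`. -/
def IsTwistorLine (L : Set CP3) : Prop := ∃ q : HP1, L = twistorProj ⁻¹' {q}

/-- The zero locus `{f = 0} ⊆ ℂℙ³`, for a homogeneous polynomial `f`. -/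
def zeroLocus (f : MvPolynomial (Fin 4) ℂ) : Set CP3 := {p | MvPolynomial.eval p.rep f = 0}

/-- Membership in the zero locus of a homogeneous polynomial can be tested on any representative. -/
theorem mk_mem_zeroLocus_iff {f : MvPolynomial (Fin 4) ℂ} {d : ℕ} (hf : f.IsHomogeneous d)
    (v : Fin 4 → ℂ) (hv : v ≠ 0) :
    Projectivization.mk ℂ v hv ∈ zeroLocus f ↔ MvPolynomial.eval v f = 0 := by
  obtain ⟨a, ha⟩ := Projectivization.exists_smul_eq_mk_rep ℂ v hv
  have key : MvPolynomial.eval ((a : ℂ) • v) f = (a : ℂ) ^ d * MvPolynomial.eval v f := by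
    rw [MvPolynomial.eval_eq, MvPolynomial.eval_eq, Finset.mul_sum]
    refine Finset.sum_congr rfl fun m hm => ?_
    have hd : ∑ i, m i = d := by
      have := hf (MvPolynomial.mem_support_iff.mp hm)
      rw [Finsupp.weight_apply, Finsupp.sum_fintype _ _ (by simp)] at this
      simpa using this
    have hs : ∑ i ∈ m.support, m i = d := by
      rw [← hd]
      exact Finset.sum_subset (Finset.subset_univ _) (by simp)
    simp only [Pi.smul_apply, smul_eq_mul, mul_pow, Finset.prod_mul_distrib,
      Finset.prod_pow_eq_pow_sum, hs]
    ring
  have h2 : (Projectivization.mk ℂ v hv).rep = (a : ℂ) • v := ha.symm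
  simp [zeroLocus, h2, key]

/-- Planes in `ℂℙ³`: zero loci of nonzero linear forms. -/
def IsPlane (H : Set CP3) : Prop :=
  ∃ l : MvPolynomial (Fin 4) ℂ, l ≠ 0 ∧ l.IsHomogeneous 1 ∧ H = zeroLocus l

/-- The twistor discriminant locus of the surface `X` of degree `d`: the points `q` such that
`π⁻¹(q) ∩ X` does not have exactly `d` points. A fibre contained in `X` has infinitely many points,
hence the `ℕ∞`-valued cardinality. -/
def Disc (d : ℕ) (X : Set CP3) : Set HP1 :=
  {q | (twistorProj ⁻¹' {q} ∩ X).encard ≠ d}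

end Twistor

/-!
With `j (z₀, z₁, z₂, z₃) = (-z̄₁, z̄₀, -z̄₃, z̄₂)`, twistor lines are the two-dimensional
subspaces of `ℂ⁴` stable under the antilinear map `j`; any two are equal or complementary, and every
hyperplane contains exactly one.

Away from the discriminant locus, `π` restricts to a covering map of the surface. Suppose that the
discriminant locus is finite, let `p` be a point of the surface on a regular twistor line, and
suppose that the twistor line `L` in the tangent plane at `p` were regular. Move a line from `L`
to a line through `p` meeting `L`, avoiding the twistor lines over the discriminant locus. Since the
parameter space is simply connected, the `d` sheets of the covering extend over it, and each of
them keeps meeting the moving line: the set of good times is open as long as the `d` intersections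
are transversal, and closed by compactness. So the last line meets the surface transversally at `p`,
although it is tangent there. Hence `L` lies over the finite discriminant locus, so it is locally
independent of `p`; as tangency along a fixed direction integrates to a line in the surface, the
surface contains its tangent plane at `p`.

A regular twistor line thus gives `d` distinct planes in the surface. Two of them meet in a line of
singular points, all of whose twistor lines are irregular, so this line is itself a twistor line;
it is the one contained in each plane. By degree, there is no room for further points of the
surface.
-/

namespace Twistor

open Filter Topology Module

local notation "ℂ⁴" => Fin 4 → ℂ

/-- Left multiplication by `j` on `ℍ²`, transported to `ℂ⁴` by `toQuat`. -/
noncomputable def jMap : ℂ⁴ →L⋆[ℂ] ℂ⁴ where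
  toFun z := ![-star (z 1), star (z 0), -star (z 3), star (z 2)]
  map_add' z w := by ext i; fin_cases i <;> simp <;> ring
  map_smul' t z := by ext i; fin_cases i <;> simp
  cont := by
    refine continuous_pi fun i => ?_
    fin_cases i <;> dsimp <;> fun_prop

theorem jMap_apply (z : ℂ⁴) : jMap z = ![-star (z 1), star (z 0), -star (z 3), star (z 2)] := rfl

@[simp]
theorem jMap_jMap (z : ℂ⁴) : jMap (jMap z) = -z := by
  ext i
  fin_cases i <;> simp [jMap_apply]

theorem star_dotProduct_jMap (z : ℂ⁴) : star z ⬝ᵥ jMap z = 0 := by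
  simp only [dotProduct, Fin.sum_univ_four, jMap_apply, Pi.star_apply, Matrix.cons_val]
  ring

theorem star_jMap_dotProduct (z : ℂ⁴) : star (jMap z) ⬝ᵥ z = 0 := by
  simp only [dotProduct, Fin.sum_univ_four, jMap_apply, Pi.star_apply, Matrix.cons_val, star_neg,
    star_star]
  ring

theorem star_jMap_dotProduct_jMap (z : ℂ⁴) : star (jMap z) ⬝ᵥ jMap z = star z ⬝ᵥ z := by
  simp only [dotProduct, Fin.sum_univ_four, jMap_apply, Pi.star_apply, Matrix.cons_val, star_neg,
    star_star]
  ring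

open scoped ComplexOrder in
theorem star_dotProduct_self_ne_zero {z : ℂ⁴} (hz : z ≠ 0) : star z ⬝ᵥ z ≠ 0 := by
  rwa [Ne, dotProduct_star_self_eq_zero]

/-- The complex plane `ℍ z ⊆ ℂ⁴`: for `z ≠ 0`, its projectivization is the twistor line
through `[z]`. -/
def fibre (z : ℂ⁴) : Submodule ℂ ℂ⁴ := Submodule.span ℂ {z, jMap z}

theorem mem_fibre {z w : ℂ⁴} : w ∈ fibre z ↔ ∃ u v : ℂ, u • z + v • jMap z = w :=
  Submodule.mem_span_pair

theorem self_mem_fibre (z : ℂ⁴) : z ∈ fibre z := Submodule.subset_span (by simp)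

theorem jMap_mem_fibre {z w : ℂ⁴} (hw : w ∈ fibre z) : jMap w ∈ fibre z := by
  obtain ⟨u, v, rfl⟩ := mem_fibre.1 hw
  refine mem_fibre.2 ⟨-star v, star u, ?_⟩
  simp [add_comm]

theorem fibre_le_iff {z : ℂ⁴} {S : Submodule ℂ ℂ⁴} : fibre z ≤ S ↔ z ∈ S ∧ jMap z ∈ S := by
  simp [fibre, Submodule.span_le, Set.insert_subset_iff]

theorem linearIndependent_jMap {z : ℂ⁴} (hz : z ≠ 0) : LinearIndependent ℂ ![z, jMap z] := by
  refine LinearIndependent.pair_iff.2 fun u v h => ?_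
  have hu : u * (star z ⬝ᵥ z) = 0 := by
    simpa [star_dotProduct_jMap] using congrArg (star z ⬝ᵥ ·) h
  have hv : v * (star z ⬝ᵥ z) = 0 := by
    simpa [star_jMap_dotProduct, star_jMap_dotProduct_jMap] using congrArg (star (jMap z) ⬝ᵥ ·) h
  have hne := star_dotProduct_self_ne_zero hz
  exact ⟨(mul_eq_zero.1 hu).resolve_right hne, (mul_eq_zero.1 hv).resolve_right hne⟩

theorem finrank_fibre {z : ℂ⁴} (hz : z ≠ 0) : finrank ℂ (fibre z) = 2 := by
  rw [fibre, ← Matrix.range_cons_cons_empty]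
  simpa using finrank_span_eq_card (linearIndependent_jMap hz)

theorem fibre_eq_of_mem {z w : ℂ⁴} (hw0 : w ≠ 0) (hw : w ∈ fibre z) : fibre w = fibre z := by
  have hz : z ≠ 0 := by
    rintro rfl
    exact hw0 (by simpa [fibre] using hw)
  exact Submodule.eq_of_le_of_finrank_eq (fibre_le_iff.2 ⟨hw, jMap_mem_fibre hw⟩)
    (by rw [finrank_fibre hw0, finrank_fibre hz])

theorem disjoint_fibre {z w : ℂ⁴} (h : fibre z ≠ fibre w) : Disjoint (fibre z) (fibre w) := by
  refine Submodule.disjoint_def.2 fun x hz hw => ?_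
  by_contra hx
  exact h ((fibre_eq_of_mem hx hz).symm.trans (fibre_eq_of_mem hx hw))

theorem fibre_sup_fibre {z w : ℂ⁴} (hz : z ≠ 0) (hw : w ≠ 0) (h : fibre z ≠ fibre w) :
    fibre z ⊔ fibre w = ⊤ := by
  apply Submodule.eq_top_of_disjoint
  · simp [finrank_fibre hz, finrank_fibre hw]
  · exact disjoint_fibre h

theorem fibre_eq_of_le_ker {φ : ℂ⁴ →ₗ[ℂ] ℂ} (hφ : φ ≠ 0) {z w : ℂ⁴} (hz : z ≠ 0) (hw : w ≠ 0)
    (hzφ : fibre z ≤ φ.ker) (hwφ : fibre w ≤ φ.ker) : fibre z = fibre w := by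
  by_contra h
  exact hφ (LinearMap.ker_eq_top.1 (top_le_iff.1 (fibre_sup_fibre hz hw h ▸ sup_le hzφ hwφ)))

theorem exists_fibre_le_ker (φ : ℂ⁴ →ₗ[ℂ] ℂ) : ∃ e ≠ 0, fibre e ≤ φ.ker := by
  let ψ : ℂ⁴ →ₗ[ℂ] ℂ :=
    { toFun := fun z => star (φ (jMap z))
      map_add' := by simp
      map_smul' := by simp }
  obtain ⟨e, he, hne⟩ := (Submodule.ne_bot_iff _).1
    (LinearMap.ker_ne_bot_of_finrank_lt (f := φ.prod ψ) (by simp))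
  obtain ⟨h, h'⟩ : φ e = 0 ∧ star (φ (jMap e)) = 0 := by simpa [ψ] using he
  exact ⟨e, hne, fibre_le_iff.2 ⟨h, by simpa using h'⟩⟩

theorem toQuat_smul_add_smul_jMap (z : ℂ⁴) (u v : ℂ) :
    toQuat (u • z + v • jMap z) = ((u : ℍ[ℝ]) + (v : ℍ[ℝ]) * quatJ) • toQuat z := by
  have hJ : quatJ.re = 0 ∧ quatJ.imI = 0 ∧ quatJ.imJ = 1 ∧ quatJ.imK = 0 := ⟨rfl, rfl, rfl, rfl⟩
  funext i
  fin_cases i <;> ext <;>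
    simp [toQuat, jMap_apply, hJ, Quaternion.re_mul, Quaternion.imI_mul,
      Quaternion.imJ_mul, Quaternion.imK_mul] <;> ring

theorem eq_coe_add_coe_mul_quatJ (q : ℍ[ℝ]) :
    q = ((⟨q.re, q.imI⟩ : ℂ) : ℍ[ℝ]) + ((⟨q.imJ, q.imK⟩ : ℂ) : ℍ[ℝ]) * quatJ := by
  have hJ : quatJ.re = 0 ∧ quatJ.imI = 0 ∧ quatJ.imJ = 1 ∧ quatJ.imK = 0 := ⟨rfl, rfl, rfl, rfl⟩
  ext <;> simp [hJ, Quaternion.re_mul, Quaternion.imI_mul, Quaternion.imJ_mul, Quaternion.imK_mul]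

theorem toQuat_injective : Function.Injective toQuat := by
  intro z w h
  have hsub : toQuat (z - w) = toQuat z - toQuat w := by
    funext i
    fin_cases i <;> simp [toQuat, ← Quaternion.coe_ofComplex, sub_mul] <;> abel
  by_contra hne
  exact toQuat_ne_zero (sub_ne_zero.2 hne) (by rw [hsub, h, sub_self])

theorem toQuat_surjective : Function.Surjective toQuat := by
  refine fun x => ⟨![⟨(x 0).re, (x 0).imI⟩, ⟨(x 0).imJ, (x 0).imK⟩, ⟨(x 1).re, (x 1).imI⟩,
    ⟨(x 1).imJ, (x 1).imK⟩], funext fun i => ?_⟩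
  fin_cases i
  · exact (eq_coe_add_coe_mul_quatJ (x 0)).symm
  · exact (eq_coe_add_coe_mul_quatJ (x 1)).symm

theorem twistorProj_mk_eq_iff {z w : ℂ⁴} (hz : z ≠ 0) (hw : w ≠ 0) :
    twistorProj (.mk ℂ w hw) = twistorProj (.mk ℂ z hz) ↔ w ∈ fibre z := by
  change Projectivization.mk ℍ[ℝ] (toQuat w) (toQuat_ne_zero hw) =
    Projectivization.mk ℍ[ℝ] (toQuat z) (toQuat_ne_zero hz) ↔ _
  rw [Projectivization.mk_eq_mk_iff', mem_fibre]
  constructor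
  · rintro ⟨q, hq⟩
    refine ⟨⟨q.re, q.imI⟩, ⟨q.imJ, q.imK⟩, toQuat_injective ?_⟩
    rw [toQuat_smul_add_smul_jMap, ← eq_coe_add_coe_mul_quatJ, hq]
  · rintro ⟨u, v, rfl⟩
    exact ⟨_, (toQuat_smul_add_smul_jMap z u v).symm⟩

theorem exists_twistorProj_mk_eq (q : HP1) :
    ∃ (z : ℂ⁴) (hz : z ≠ 0), twistorProj (.mk ℂ z hz) = q := by
  induction q using Projectivization.ind with
  | h x hx =>
    obtain ⟨z, rfl⟩ := toQuat_surjective x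
    refine ⟨z, ?_, rfl⟩
    rintro rfl
    exact hx (by simpa using toQuat_smul 0 0)

section Polynomial

variable {σ R : Type*} [CommRing R]

/-- The univariate polynomial `t ↦ f (w + t x)`. -/
noncomputable def linePoly (f : MvPolynomial σ R) (w x : σ → R) : Polynomial R :=
  MvPolynomial.aeval (fun i => Polynomial.C (w i) + Polynomial.C (x i) * Polynomial.X) f

theorem eval_linePoly (f : MvPolynomial σ R) (w x : σ → R) (t : R) :
    (linePoly f w x).eval t = MvPolynomial.eval (w + t • x) f := by
  rw [linePoly, ← Polynomial.coe_aeval_eq_eval, MvPolynomial.comp_aeval_apply,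
    ← MvPolynomial.coe_aeval_eq_eval]
  simp only [map_add, map_mul, Polynomial.aeval_C, Polynomial.aeval_X, Algebra.algebraMap_self,
    RingHom.id_apply, mul_comm]
  rfl

variable {f : MvPolynomial σ R} {d : ℕ}

theorem natDegree_linePoly_le (hf : f.IsHomogeneous d) (w x : σ → R) :
    (linePoly f w x).natDegree ≤ d := by
  simpa [linePoly] using MvPolynomial.aeval_natDegree_le f hf.totalDegree_le
    (fun i => Polynomial.C (w i) + Polynomial.C (x i) * Polynomial.X) (n := 1)
    (fun i => by compute_degree)

theorem eval_smul (hf : f.IsHomogeneous d) (t : R) (z : σ → R) :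
    MvPolynomial.eval (t • z) f = t ^ d * MvPolynomial.eval z f := by
  rw [MvPolynomial.eval_eq, MvPolynomial.eval_eq, Finset.mul_sum]
  refine Finset.sum_congr rfl fun m hm => ?_
  have hs : ∑ i ∈ m.support, m i = d := by
    rw [← hf (MvPolynomial.mem_support_iff.mp hm), Finsupp.weight_apply, Finsupp.sum]
    simp
  simp only [Pi.smul_apply, smul_eq_mul, mul_pow, Finset.prod_mul_distrib,
    Finset.prod_pow_eq_pow_sum, hs]
  ring

theorem eval_smul_eq_zero_iff [NoZeroDivisors R] (hf : f.IsHomogeneous d) {t : R} (ht : t ≠ 0)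
    {z : σ → R} : MvPolynomial.eval (t • z) f = 0 ↔ MvPolynomial.eval z f = 0 := by
  rw [eval_smul hf, mul_eq_zero, or_iff_right (pow_ne_zero _ ht)]

theorem reflect_linePoly {K : Type*} [Field K] [Infinite K] {f : MvPolynomial σ K}
    (hf : f.IsHomogeneous d) (w x : σ → K) :
    Polynomial.reflect d (linePoly f w x) = linePoly f x w := by
  refine Polynomial.eq_of_infinite_eval_eq _ _
    ((Set.finite_singleton (0 : K)).infinite_compl.mono fun t ht => ?_)
  have ht : t ≠ 0 := ht
  have : Invertible t⁻¹ := invertibleOfNonzero (inv_ne_zero ht)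
  have h := Polynomial.eval₂_reflect_mul_pow (RingHom.id K) t⁻¹ d (linePoly f w x)
    (natDegree_linePoly_le hf w x)
  rw [invOf_eq_inv, inv_inv, ← Polynomial.eval, ← Polynomial.eval, eval_linePoly] at h
  have hline : x + t • w = t • (w + t⁻¹ • x) := by
    rw [smul_add, smul_inv_smul₀ ht, add_comm]
  rw [Set.mem_ofPred_eq, eval_linePoly, hline, eval_smul hf, ← h, inv_pow, mul_comm, mul_assoc,
    inv_mul_cancel₀ (pow_ne_zero _ ht), mul_one]

theorem coeff_linePoly {K : Type*} [Field K] [Infinite K] {f : MvPolynomial σ K}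
    (hf : f.IsHomogeneous d) (w x : σ → K) : (linePoly f w x).coeff d = MvPolynomial.eval x f := by
  have h : (linePoly f x w).coeff 0 = MvPolynomial.eval x f := by
    rw [Polynomial.coeff_zero_eq_eval_zero, eval_linePoly, zero_smul, add_zero]
  rw [← h, ← reflect_linePoly hf w x, Polynomial.coeff_reflect, Polynomial.revAt_zero]

theorem linePoly_ne_zero {K : Type*} [Field K] [Infinite K] {f : MvPolynomial σ K}
    (hf : f.IsHomogeneous d) (w : σ → K) {x : σ → K} (hx : MvPolynomial.eval x f ≠ 0) :
    linePoly f w x ≠ 0 := fun h => hx (by rw [← coeff_linePoly hf w, h, Polynomial.coeff_zero])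

theorem finite_setOf_eval_add_smul_eq_zero {K : Type*} [Field K] [Infinite K]
    {f : MvPolynomial σ K} (hf : f.IsHomogeneous d) (w : σ → K) {x : σ → K}
    (hx : MvPolynomial.eval x f ≠ 0) : {t : K | MvPolynomial.eval (w + t • x) f = 0}.Finite := by
  simpa only [Polynomial.IsRoot, eval_linePoly] using
    Polynomial.finite_setOfPred_isRoot (linePoly_ne_zero hf w hx)

theorem eval_derivative_ne_zero_of_le_encard {K : Type*} [Field K] {P : Polynomial K} (hP : P ≠ 0)
    (hdeg : P.natDegree ≤ d) (hd : d ≤ {t | P.IsRoot t}.encard) {t : K} (ht : P.IsRoot t) :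
    P.derivative.eval t ≠ 0 := by
  classical
  intro ht'
  have hroots : {t | P.IsRoot t} = P.roots.toFinset := by
    ext
    simp [hP]
  rw [hroots, Set.encard_coe_eq_coe_finsetCard, Nat.cast_le] at hd
  have hnodup := Multiset.toFinset_card_eq_card_iff_nodup.1
    ((Multiset.toFinset_card_le _).antisymm (P.card_roots'.trans (hdeg.trans hd)))
  have hmult := (Polynomial.one_lt_rootMultiplicity_iff_isRoot hP).2 ⟨ht, ht'⟩
  rw [← Polynomial.count_roots] at hmult
  exact hmult.not_ge (Multiset.nodup_iff_count_le_one.1 hnodup t)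

end Polynomial

section Derivative

variable {σ 𝕜 : Type*} [RCLike 𝕜] {f : MvPolynomial σ 𝕜} {d : ℕ}

theorem contDiff_eval [Fintype σ] (f : MvPolynomial σ 𝕜) :
    ContDiff 𝕜 ⊤ fun z : σ → 𝕜 => MvPolynomial.eval z f :=
  (AnalyticOnNhd.eval_mvPolynomial f).contDiff

/-- The differential of a polynomial function. -/
noncomputable def polyDeriv (f : MvPolynomial σ 𝕜) (z : σ → 𝕜) : (σ → 𝕜) →L[𝕜] 𝕜 :=
  fderiv 𝕜 (fun z => MvPolynomial.eval z f) z

theorem continuous_polyDeriv [Finite σ] (f : MvPolynomial σ 𝕜) : Continuous (polyDeriv f) := by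
  cases nonempty_fintype σ
  exact (contDiff_eval f).continuous_fderiv (by simp)

theorem continuous_polyDeriv_apply [Finite σ] (f : MvPolynomial σ 𝕜) (x : σ → 𝕜) :
    Continuous fun z => polyDeriv f z x := by
  cases nonempty_fintype σ
  exact (continuous_polyDeriv f).clm_apply continuous_const

theorem hasFDerivAt_eval [Finite σ] (f : MvPolynomial σ 𝕜) (z : σ → 𝕜) :
    HasFDerivAt (fun z => MvPolynomial.eval z f) (polyDeriv f z) z := by
  cases nonempty_fintype σ
  exact ((contDiff_eval f).differentiable (by simp) z).hasFDerivAt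

theorem hasDerivAt_eval_line [Finite σ] (f : MvPolynomial σ 𝕜) (w x : σ → 𝕜) (t : 𝕜) :
    HasDerivAt (fun t : 𝕜 => MvPolynomial.eval (w + t • x) f) (polyDeriv f (w + t • x) x) t := by
  cases nonempty_fintype σ
  have h : HasDerivAt (fun t : 𝕜 => w + t • x) x t := by
    simpa using ((hasDerivAt_id t).smul_const x).const_add w
  exact (hasFDerivAt_eval f (w + t • x)).comp_hasDerivAt t h

theorem eval_derivative_linePoly [Finite σ] (f : MvPolynomial σ 𝕜) (w x : σ → 𝕜) (t : 𝕜) :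
    (linePoly f w x).derivative.eval t = polyDeriv f (w + t • x) x := by
  have h := (linePoly f w x).hasDerivAt t
  simp only [eval_linePoly] at h
  exact h.unique (hasDerivAt_eval_line f w x t)

/-- Euler's identity. -/
theorem polyDeriv_self [Finite σ] (hf : f.IsHomogeneous d) (z : σ → 𝕜) :
    polyDeriv f z z = d * MvPolynomial.eval z f := by
  have h := hasDerivAt_eval_line f 0 z 1
  simp only [zero_add, one_smul, eval_smul hf] at h
  simpa using h.unique (((hasDerivAt_id (1 : 𝕜)).pow d).mul_const (MvPolynomial.eval z f))

theorem polyDeriv_ne_zero_of_le_encard [Finite σ] (hf : f.IsHomogeneous d) {w x : σ → 𝕜}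
    (hx : MvPolynomial.eval x f ≠ 0)
    (hd : d ≤ {t : 𝕜 | MvPolynomial.eval (w + t • x) f = 0}.encard)
    {t : 𝕜} (ht : MvPolynomial.eval (w + t • x) f = 0) : polyDeriv f (w + t • x) x ≠ 0 := by
  rw [← eval_derivative_linePoly]
  refine eval_derivative_ne_zero_of_le_encard (linePoly_ne_zero hf w hx)
    (natDegree_linePoly_le hf w x) ?_ ?_ <;> simpa only [Polynomial.IsRoot, eval_linePoly]

/-- The implicit function theorem for the root of `t ↦ f (z + t x)` near a simple root `t = 0`. -/
theorem exists_contDiffAt_root [Fintype σ] {w y : σ → 𝕜} (hw : MvPolynomial.eval w f = 0)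
    (hy : polyDeriv f w y ≠ 0) :
    ∃ ρ : (σ → 𝕜) × (σ → 𝕜) → 𝕜, ContDiffAt 𝕜 1 ρ (w, y) ∧ ρ (w, y) = 0 ∧
      (∀ᶠ v in 𝓝 (w, y), MvPolynomial.eval (v.1 + ρ v • v.2) f = 0) ∧
      ∀ᶠ u in 𝓝 ((w, y), (0 : 𝕜)), MvPolynomial.eval (u.1.1 + u.2 • u.1.2) f = 0 → ρ u.1 = u.2 := by
  let F : ((σ → 𝕜) × (σ → 𝕜)) × 𝕜 → 𝕜 := fun u => MvPolynomial.eval (u.1.1 + u.2 • u.1.2) f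
  have hF : ContDiffAt 𝕜 1 F ((w, y), 0) :=
    (((contDiff_eval f).of_le le_top).comp (by fun_prop)).contDiffAt
  have hF0 : F ((w, y), 0) = 0 := by simp [F, hw]
  have hpartial : fderiv 𝕜 F ((w, y), 0) (0, 1) = polyDeriv f w y := by
    have h := ((hF.differentiableAt one_ne_zero).hasFDerivAt).comp_hasDerivAt (0 : 𝕜)
      ((hasDerivAt_const (0 : 𝕜) (w, y)).prodMk (hasDerivAt_id (0 : 𝕜)))
    simpa using h.unique (hasDerivAt_eval_line f w y 0)
  have hinv : (fderiv 𝕜 F ((w, y), 0) ∘L .inr 𝕜 _ 𝕜).IsInvertible := by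
    refine ⟨.unitsEquivAut 𝕜 (Units.mk0 _ (hpartial ▸ hy)), ?_⟩
    ext
    simp
  refine ⟨hF.implicitFunction one_ne_zero hinv, hF.contDiffAt_implicitFunction one_ne_zero hinv,
    hF.implicitFunction_apply_self one_ne_zero hinv, ?_, ?_⟩
  · simpa only [hF0] using hF.eventually_apply_implicitFunction one_ne_zero hinv
  · filter_upwards [hF.eventually_apply_eq_iff_implicitFunction one_ne_zero hinv] with u hu h
    exact hu.1 (h.trans hF0.symm)

end Derivative

section Regular

variable {f : MvPolynomial (Fin 4) ℂ} {d : ℕ} {w y z : ℂ⁴}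

/-- `z` is a nonzero vector whose twistor line meets the surface `{f = 0}` in exactly `d` points. -/
def IsRegular (f : MvPolynomial (Fin 4) ℂ) (d : ℕ) (z : ℂ⁴) : Prop :=
  ∃ hz : z ≠ 0, twistorProj (.mk ℂ z hz) ∉ Disc d (zeroLocus f)

theorem IsRegular.of_mem_fibre (h : IsRegular f d z) (hw0 : w ≠ 0) (hw : w ∈ fibre z) :
    IsRegular f d w :=
  ⟨hw0, by rw [(twistorProj_mk_eq_iff h.1 hw0).2 hw]; exact h.2⟩

theorem IsRegular.encard (h : IsRegular f d z) :
    (twistorProj ⁻¹' {twistorProj (.mk ℂ z h.1)} ∩ zeroLocus f).encard = d :=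
  not_not.1 h.2

theorem add_smul_ne_zero (h : LinearIndependent ℂ ![w, y]) (t : ℂ) : w + t • y ≠ 0 := fun h0 =>
  one_ne_zero (LinearIndependent.pair_iff.1 h 1 t (by rwa [one_smul])).1

theorem mk_add_smul_injective (h : LinearIndependent ℂ ![w, y]) :
    Function.Injective fun t : ℂ => Projectivization.mk ℂ (w + t • y) (add_smul_ne_zero h t) := by
  intro t s hts
  obtain ⟨a, ha⟩ := (Projectivization.mk_eq_mk_iff' ..).1 hts
  obtain ⟨h1, h2⟩ := LinearIndependent.pair_iff.1 h (a - 1) (a * s - t)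
    (by linear_combination (norm := module) ha)
  linear_combination s * h1 - h2

theorem exists_smul_add_smul_eq {v : ℂ⁴} (hwy : LinearIndependent ℂ ![w, y]) (hy : y ∈ fibre w)
    (hv : v ∈ fibre w) : ∃ a b : ℂ, a • w + b • y = v := by
  have hspan : Submodule.span ℂ {w, y} = fibre w := by
    refine Submodule.eq_of_le_of_finrank_eq
      (Submodule.span_le.2 (Set.pair_subset (self_mem_fibre w) hy)) ?_
    rw [finrank_fibre (by simpa using add_smul_ne_zero hwy 0),
      ← Matrix.range_cons_cons_empty w y ![]]
    simpa using finrank_span_eq_card hwy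
  exact Submodule.mem_span_pair.1 (hspan ▸ hv)

theorem encard_fibre_inter_zeroLocus (hf : f.IsHomogeneous d) (hwy : LinearIndependent ℂ ![w, y])
    (hy : y ∈ fibre w) (hfy : MvPolynomial.eval y f ≠ 0) (hw : w ≠ 0) :
    (twistorProj ⁻¹' {twistorProj (.mk ℂ w hw)} ∩ zeroLocus f).encard =
      {t : ℂ | MvPolynomial.eval (w + t • y) f = 0}.encard := by
  rw [← (mk_add_smul_injective hwy).encard_image]
  congr 1
  ext x
  induction x using Projectivization.ind with
  | h v hv =>
    rw [Set.mem_inter_iff, Set.mem_preimage, Set.mem_singleton_iff, twistorProj_mk_eq_iff hw hv,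
      mk_mem_zeroLocus_iff hf]
    constructor
    · rintro ⟨hvw, hv0⟩
      obtain ⟨a, b, rfl⟩ := exists_smul_add_smul_eq hwy hy hvw
      have ha : a ≠ 0 := by
        rintro rfl
        rw [zero_smul, zero_add] at hv hv0
        exact hfy ((eval_smul_eq_zero_iff hf (left_ne_zero_of_smul hv)).1 hv0)
      have hab : a • (w + (b / a) • y) = a • w + b • y := by
        rw [smul_add, smul_smul, mul_div_cancel₀ _ ha]
      refine ⟨b / a, (eval_smul_eq_zero_iff hf ha).1 (hab ▸ hv0), ?_⟩
      exact ((Projectivization.mk_eq_mk_iff' ..).2 ⟨a, hab⟩).symm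
    · rintro ⟨t, ht, htv⟩
      obtain ⟨a, ha⟩ := (Projectivization.mk_eq_mk_iff' ..).1 htv.symm
      rw [← ha] at hv ⊢
      exact ⟨(fibre w).smul_mem a
        ((fibre w).add_mem (self_mem_fibre w) ((fibre w).smul_mem t hy)),
        (eval_smul_eq_zero_iff hf (left_ne_zero_of_smul hv)).2 ht⟩

theorem isRegular_iff_encard (hf : f.IsHomogeneous d) (hwy : LinearIndependent ℂ ![w, y])
    (hy : y ∈ fibre w) (hfy : MvPolynomial.eval y f ≠ 0) :
    IsRegular f d w ↔ {t : ℂ | MvPolynomial.eval (w + t • y) f = 0}.encard = d := by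
  have hw : w ≠ 0 := by simpa using add_smul_ne_zero hwy 0
  rw [← encard_fibre_inter_zeroLocus hf hwy hy hfy hw]
  exact ⟨IsRegular.encard, fun h => ⟨hw, not_not.2 h⟩⟩

theorem IsRegular.exists_eval_ne_zero (hf : f.IsHomogeneous d) (h : IsRegular f d w) :
    ∃ y ∈ fibre w, LinearIndependent ℂ ![w, y] ∧ MvPolynomial.eval y f ≠ 0 := by
  by_contra! h0
  have hj := jMap_mem_fibre (self_mem_fibre w)
  have hli := linearIndependent_jMap h.1
  refine Set.infinite_range_of_injective
    (mk_add_smul_injective (LinearIndependent.pair_symm_iff.1 hli))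
    ((Set.finite_of_encard_eq_coe h.encard).subset ?_)
  rintro _ ⟨r, rfl⟩
  have hr : jMap w + r • w ∈ fibre w :=
    (fibre w).add_mem hj ((fibre w).smul_mem r (self_mem_fibre w))
  refine ⟨(twistorProj_mk_eq_iff h.1 _).2 hr, (mk_mem_zeroLocus_iff hf _ _).2 (h0 _ hr ?_)⟩
  rw [add_comm, LinearIndependent.pair_add_smul_right_iff]
  exact hli

theorem IsRegular.polyDeriv_jMap_ne_zero (hf : f.IsHomogeneous d) (h : IsRegular f d w)
    (hw : MvPolynomial.eval w f = 0) : polyDeriv f w (jMap w) ≠ 0 := by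
  obtain ⟨y, hy, hwy, hfy⟩ := h.exists_eval_ne_zero hf
  have hcard := (isRegular_iff_encard hf hwy hy hfy).1 h
  have hne := polyDeriv_ne_zero_of_le_encard hf hfy hcard.ge (t := 0) (by simpa using hw)
  obtain ⟨a, b, rfl⟩ := mem_fibre.1 hy
  intro h0
  simp [polyDeriv_self hf, hw, h0] at hne

end Regular

section Topology

theorem isOpenQuotientMap_of_correspondence {E Y ι : Type*} [TopologicalSpace E]
    [TopologicalSpace Y] {p : E → Prop} (hp : IsOpen {x | p x}) {q : {x // p x} → Y}
    (hq : IsQuotientMap q) {A : ι → E → E} (hA : ∀ i, Continuous (A i))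
    (h : ∀ x y, q x = q y ↔ ∃ i, A i y.1 = x.1) : IsOpenQuotientMap q := by
  refine IsOpenQuotientMap.iff_isOpenMap_isQuotientMap.2 ⟨fun U hU => ?_, hq⟩
  have hsat : q ⁻¹' (q '' U) = ⋃ i, Subtype.val ⁻¹' (A i ⁻¹' (Subtype.val '' U)) := by
    ext y
    simp only [Set.mem_preimage, Set.mem_image, h, Set.mem_iUnion, Subtype.exists]
    constructor
    · rintro ⟨x, hx, hxU, i, hi⟩
      exact ⟨i, x, hx, hxU, hi.symm⟩
    · rintro ⟨i, x, hx, hxU, hi⟩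
      exact ⟨x, hx, hxU, i, hi.symm⟩
  rw [← hq.isOpen_preimage, hsat]
  exact isOpen_iUnion fun i =>
    ((hp.isOpenMap_subtype_val U hU).preimage (hA i)).preimage continuous_subtype_val

theorem eventually_nhds_quotient_iff {E Y : Type*} [TopologicalSpace E] [TopologicalSpace Y]
    {p : E → Prop} (hp : IsOpen {x | p x}) {q : {x // p x} → Y} (hq : IsOpenQuotientMap q)
    (x : {x // p x}) {P : Y → Prop} :
    (∀ᶠ y in 𝓝 (q x), P y) ↔ ∀ᶠ z in 𝓝 x.1, ∀ hz : p z, P (q ⟨z, hz⟩) := by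
  rw [← hq.map_nhds_eq x, eventually_map, ← hp.isOpenEmbedding_subtypeVal.map_nhds_eq x,
    eventually_map]
  exact eventually_congr (.of_forall fun a => ⟨fun h _ => h, fun h => h a.2⟩)

/-- The quotient topology of `ℂ⁴ ∖ {0}`. -/
noncomputable instance : TopologicalSpace CP3 :=
  .coinduced (fun z : {z : ℂ⁴ // z ≠ 0} => Projectivization.mk ℂ z.1 z.2) inferInstance

/-- The quotient topology of `ℂℙ³`; it is also that of `ℍ² ∖ {0}`, as `toQuat` is a
homeomorphism. -/
noncomputable instance : TopologicalSpace HP1 := .coinduced twistorProj inferInstance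

theorem isOpenQuotientMap_mk :
    IsOpenQuotientMap fun z : {z : ℂ⁴ // z ≠ 0} => Projectivization.mk ℂ z.1 z.2 := by
  refine isOpenQuotientMap_of_correspondence isOpen_ne
    ⟨⟨rfl⟩, fun x => ⟨⟨x.rep, x.rep_nonzero⟩, x.mk_rep⟩⟩ (fun t : ℂ => continuous_const_smul t)
    fun z w => ?_
  rw [Projectivization.mk_eq_mk_iff']

theorem isOpenQuotientMap_twistorProj_mk :
    IsOpenQuotientMap fun z : {z : ℂ⁴ // z ≠ 0} => twistorProj (.mk ℂ z.1 z.2) := by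
  have hπ : IsQuotientMap twistorProj := ⟨⟨rfl⟩, fun q => by
    obtain ⟨z, hz, h⟩ := exists_twistorProj_mk_eq q
    exact ⟨_, h⟩⟩
  refine isOpenQuotientMap_of_correspondence isOpen_ne (hπ.comp isOpenQuotientMap_mk.isQuotientMap)
    (A := fun (c : ℂ × ℂ) w => c.1 • w + c.2 • jMap w) (fun c => by fun_prop) fun z w => ?_
  rw [twistorProj_mk_eq_iff w.2 z.2, mem_fibre, Prod.exists]

theorem continuous_twistorProj : Continuous twistorProj := continuous_coinduced_rng

theorem continuous_projectivization_mk {A : Type*} [TopologicalSpace A] {x : A → ℂ⁴}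
    (hx : Continuous x) (h0 : ∀ a, x a ≠ 0) :
    Continuous fun a => Projectivization.mk ℂ (x a) (h0 a) :=
  isOpenQuotientMap_mk.continuous.comp (hx.subtype_mk h0)

theorem mem_fibre_iff_dotProduct {z w : ℂ⁴} (hz : z ≠ 0) :
    w ∈ fibre z ↔ (star z ⬝ᵥ z) • w = (star z ⬝ᵥ w) • z + (star (jMap z) ⬝ᵥ w) • jMap z := by
  constructor
  · intro h
    obtain ⟨u, v, rfl⟩ := mem_fibre.1 h
    simp only [dotProduct_add, dotProduct_smul, star_dotProduct_jMap, star_jMap_dotProduct,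
      star_jMap_dotProduct_jMap, smul_eq_mul]
    module
  · intro h
    have hne := star_dotProduct_self_ne_zero hz
    rw [← Submodule.smul_mem_iff _ hne, h]
    exact mem_fibre.2 ⟨_, _, rfl⟩

instance : T2Space HP1 := by
  rw [t2Space_iff_of_isOpenQuotientMap isOpenQuotientMap_twistorProj_mk]
  simp only [fun p : {z : ℂ⁴ // z ≠ 0} × {z : ℂ⁴ // z ≠ 0} => twistorProj_mk_eq_iff p.2.2 p.1.2,
    fun p : {z : ℂ⁴ // z ≠ 0} × {z : ℂ⁴ // z ≠ 0} => mem_fibre_iff_dotProduct (w := p.1.1) p.2.2]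
  apply isClosed_eq <;> fun_prop

instance : T2Space CP3 := by
  rw [t2Space_iff_of_isOpenQuotientMap isOpenQuotientMap_mk]
  have h : {p : {z : ℂ⁴ // z ≠ 0} × {z : ℂ⁴ // z ≠ 0} | Projectivization.mk ℂ p.1.1 p.1.2 =
      .mk ℂ p.2.1 p.2.2} = {p | (star p.2.1 ⬝ᵥ p.2.1) • p.1.1 = (star p.2.1 ⬝ᵥ p.1.1) • p.2.1} := by
    ext ⟨⟨z, hz⟩, w, hw⟩
    rw [Set.mem_ofPred_eq, Set.mem_ofPred_eq, Projectivization.mk_eq_mk_iff']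
    have hne := star_dotProduct_self_ne_zero hw
    constructor
    · rintro ⟨a, ha⟩
      rw [← ha, dotProduct_smul, smul_eq_mul, mul_comm, mul_smul]
    · exact fun h => ⟨(star w ⬝ᵥ z) / (star w ⬝ᵥ w), by
        rw [div_eq_inv_mul, mul_smul, ← h, inv_smul_smul₀ hne]⟩
  rw [h]
  apply isClosed_eq <;> fun_prop

instance : CompactSpace CP3 := by
  have hne : ∀ z : Metric.sphere (0 : ℂ⁴) 1, z.1 ≠ 0 := fun z => ne_zero_of_mem_unit_sphere z
  refine Function.Surjective.compactSpace
    (continuous_projectivization_mk continuous_subtype_val hne) fun x => ?_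
  have hx := norm_smul_inv_norm (𝕜 := ℂ) x.rep_nonzero
  refine ⟨⟨_, mem_sphere_zero_iff_norm.2 hx⟩, ?_⟩
  conv_rhs => rw [← x.mk_rep]
  exact (Projectivization.mk_eq_mk_iff' ..).2 ⟨_, rfl⟩

theorem isClosed_zeroLocus {f : MvPolynomial (Fin 4) ℂ} {d : ℕ} (hf : f.IsHomogeneous d) :
    IsClosed (zeroLocus f) := by
  rw [← isOpenQuotientMap_mk.isQuotientMap.isClosed_preimage]
  simp only [Set.preimage, mk_mem_zeroLocus_iff hf]
  exact isClosed_eq ((MvPolynomial.continuous_eval f).comp continuous_subtype_val) continuous_const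

end Topology

section Covering

theorem exists_isOpenEmbedding_domRestrict {X Y : Type*} [TopologicalSpace X] [TopologicalSpace Y]
    {p : X → Y} {x : X} (hp : Continuous p) (hopen : ∀ᶠ y in 𝓝 x, 𝓝 (p y) ≤ map p (𝓝 y))
    (hinj : ∃ U ∈ 𝓝 x, Set.InjOn p U) : ∃ U ∈ 𝓝 x, IsOpenEmbedding (U.domRestrict p) := by
  obtain ⟨U, hU, hinj⟩ := hinj
  obtain ⟨W, hW, hWo, hxW⟩ := mem_nhds_iff.1 (inter_mem hU hopen)
  refine ⟨W, hWo.mem_nhds hxW, .of_continuous_injective_isOpenMap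
    (hp.comp continuous_subtype_val)
    (Set.injOn_iff_injective.1 (hinj.mono fun y hy => (hW hy).1)) ?_⟩
  refine isOpenMap_iff_nhds_le.2 fun y => (hW y.2).2.trans ?_
  rw [← hWo.isOpenEmbedding_subtypeVal.map_nhds_eq y, map_map]
  rfl

variable {f : MvPolynomial (Fin 4) ℂ} {d : ℕ} {w : ℂ⁴}

theorem exists_continuousAt_section (hw : MvPolynomial.eval w f = 0)
    (hD : polyDeriv f w (jMap w) ≠ 0) :
    ∃ g : ℂ⁴ → ℂ⁴, ContinuousAt g w ∧ g w = w ∧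
      ∀ᶠ z in 𝓝 w, g z ∈ fibre z ∧ MvPolynomial.eval (g z) f = 0 := by
  obtain ⟨ρ, hρ, hρ0, hev, -⟩ := exists_contDiffAt_root hw hD
  have hpair : ContinuousAt (fun z => (z, jMap z)) w := by fun_prop
  refine ⟨fun z => z + ρ (z, jMap z) • jMap z, ?_, by simp [hρ0], ?_⟩
  · have := hρ.continuousAt.comp_of_eq hpair rfl
    exact continuousAt_id.add (this.smul (by fun_prop))
  · exact (hpair.eventually hev).mono fun z hz =>
      ⟨mem_fibre.2 ⟨1, _, by rw [one_smul]⟩, hz⟩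

theorem eventually_exists_smul_eq (hw0 : w ≠ 0) (hw : MvPolynomial.eval w f = 0)
    (hf : f.IsHomogeneous d) (hD : polyDeriv f w (jMap w) ≠ 0) :
    ∀ᶠ p in 𝓝 (w, w), MvPolynomial.eval p.1 f = 0 → MvPolynomial.eval p.2 f = 0 →
      p.2 ∈ fibre p.1 → ∃ a : ℂ, a • p.1 = p.2 := by
  obtain ⟨ρ, -, -, -, huniq⟩ := exists_contDiffAt_root hw hD
  let α : ℂ⁴ × ℂ⁴ → ℂ := fun p => (star p.1 ⬝ᵥ p.2) / (star p.1 ⬝ᵥ p.1)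
  let β : ℂ⁴ × ℂ⁴ → ℂ := fun p => (star (jMap p.1) ⬝ᵥ p.2) / (star p.1 ⬝ᵥ p.1)
  have hne := star_dotProduct_self_ne_zero hw0
  have hα : ContinuousAt α (w, w) := ContinuousAt.div (by fun_prop) (by fun_prop) hne
  have hβ : ContinuousAt β (w, w) := ContinuousAt.div (by fun_prop) (by fun_prop) hne
  have hα1 : α (w, w) = 1 := div_self hne
  have hβ0 : β (w, w) = 0 := by simp [β, star_jMap_dotProduct]
  have hs : ∀ s : ℂ⁴ × ℂ⁴ → ℂ, ContinuousAt s (w, w) → s (w, w) = 0 →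
      ∀ᶠ p in 𝓝 (w, w), MvPolynomial.eval (p.1 + s p • jMap p.1) f = 0 →
        ρ (p.1, jMap p.1) = s p := by
    intro s hs hs0
    have hc : ContinuousAt (fun p => ((p.1, jMap p.1), s p)) (w, w) := by fun_prop
    rw [ContinuousAt, hs0] at hc
    exact hc.eventually huniq
  filter_upwards [hα.eventually_ne (hα1.trans_ne one_ne_zero),
    continuousAt_fst.eventually_ne hw0, hs 0 continuousAt_const rfl,
    hs (fun p => β p / α p) (hβ.div hα (hα1.trans_ne one_ne_zero)) (by simp [hβ0])]
    with p hpα hp1 hzero hroot h1 h2 hmem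
  have hp2 : α p • (p.1 + (β p / α p) • jMap p.1) = p.2 := by
    rw [smul_add, smul_smul, mul_div_cancel₀ _ hpα]
    have hne1 := star_dotProduct_self_ne_zero hp1
    have h := (mem_fibre_iff_dotProduct hp1).1 hmem
    rw [← inv_smul_smul₀ hne1 p.2, h, smul_add, smul_smul, smul_smul, ← div_eq_inv_mul,
      ← div_eq_inv_mul]
  have hβp : β p / α p = 0 := by
    rw [← hroot, hzero]
    · rfl
    · simpa using h1
    · rwa [← eval_smul_eq_zero_iff hf hpα, hp2]
  exact ⟨α p, by rwa [hβp, zero_smul, add_zero] at hp2⟩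

theorem eval_eq_zero_of_mk_eq (hf : f.IsHomogeneous d) {x : zeroLocus f} {hw0 : w ≠ 0}
    (hx : Projectivization.mk ℂ w hw0 = x.1) : MvPolynomial.eval w f = 0 :=
  (mk_mem_zeroLocus_iff hf w hw0).1 (hx ▸ x.2)

theorem nhds_twistorProj_le (hf : f.IsHomogeneous d) {x : zeroLocus f} {hw0 : w ≠ 0}
    (hx : Projectivization.mk ℂ w hw0 = x.1) (hD : polyDeriv f w (jMap w) ≠ 0) :
    𝓝 (twistorProj x.1) ≤ map (fun y : zeroLocus f => twistorProj y.1) (𝓝 x) := by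
  intro V hV
  have hw := eval_eq_zero_of_mk_eq hf hx
  obtain ⟨g, hg, hgw, hev⟩ := exists_continuousAt_section hw hD
  obtain ⟨V', hV', hVV'⟩ := (mem_nhds_subtype ..).1 hV
  rw [← hx] at hV' ⊢
  refine (eventually_nhds_quotient_iff isOpen_ne isOpenQuotientMap_twistorProj_mk ⟨w, hw0⟩).2 ?_
  have hev' := (eventually_nhds_quotient_iff isOpen_ne isOpenQuotientMap_mk ⟨w, hw0⟩).1 hV'
  rw [ContinuousAt, hgw] at hg
  filter_upwards [hev, hg.eventually hev', hg.eventually_ne hw0] with z hz hzV hz0 hz0'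
  have hmem : twistorProj (.mk ℂ (g z) hz0) ∈ V :=
    @hVV' ⟨.mk ℂ (g z) hz0, (mk_mem_zeroLocus_iff hf _ _).2 hz.2⟩ (hzV hz0)
  rwa [(twistorProj_mk_eq_iff hz0' hz0).2 hz.1] at hmem

theorem exists_injOn_twistorProj (hf : f.IsHomogeneous d) {x : zeroLocus f} {hw0 : w ≠ 0}
    (hx : Projectivization.mk ℂ w hw0 = x.1) (hD : polyDeriv f w (jMap w) ≠ 0) :
    ∃ U ∈ 𝓝 x, Set.InjOn (fun y : zeroLocus f => twistorProj y.1) U := by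
  have hw := eval_eq_zero_of_mk_eq hf hx
  have hev := eventually_exists_smul_eq hw0 hw hf hD
  rw [nhds_prod_eq, eventually_prod_self_iff'] at hev
  obtain ⟨N, hN, hinj⟩ := hev
  have hU : ∀ᶠ y in 𝓝 x.1, ∃ z ∈ N, ∃ hz : z ≠ 0, Projectivization.mk ℂ z hz = y := by
    rw [← hx]
    refine (eventually_nhds_quotient_iff isOpen_ne isOpenQuotientMap_mk ⟨w, hw0⟩).2 ?_
    filter_upwards [hN] with z hz hz0 using ⟨z, hz, hz0, rfl⟩
  refine ⟨_, continuous_subtype_val.continuousAt.eventually hU, ?_⟩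
  rintro ⟨_, h1⟩ ⟨z1, hz1, hz10, rfl⟩ ⟨_, h2⟩ ⟨z2, hz2, hz20, rfl⟩ h
  rw [mk_mem_zeroLocus_iff hf] at h1 h2
  obtain ⟨a, ha⟩ := hinj z1 hz1 z2 hz2 h1 h2 ((twistorProj_mk_eq_iff hz10 hz20).1 h.symm)
  exact Subtype.ext ((Projectivization.mk_eq_mk_iff' ..).2 ⟨a, ha⟩).symm

theorem eventually_polyDeriv_ne_zero {x : CP3} {hw0 : w ≠ 0}
    (hx : Projectivization.mk ℂ w hw0 = x) (hD : polyDeriv f w (jMap w) ≠ 0) :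
    ∀ᶠ y in 𝓝 x, ∃ z, polyDeriv f z (jMap z) ≠ 0 ∧
      ∃ hz : z ≠ 0, Projectivization.mk ℂ z hz = y := by
  rw [← hx]
  refine (eventually_nhds_quotient_iff isOpen_ne isOpenQuotientMap_mk ⟨w, hw0⟩).2 ?_
  have hc : Continuous fun z => polyDeriv f z (jMap z) :=
    (continuous_polyDeriv f).clm_apply (by fun_prop)
  filter_upwards [hc.continuousAt.eventually_ne hD] with z hz hz0 using ⟨z, hz, hz0, rfl⟩

theorem isCoveringMapOn_twistorProj (hf : f.IsHomogeneous d) :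
    IsCoveringMapOn (fun x : zeroLocus f => twistorProj x.1) (Disc d (zeroLocus f))ᶜ := by
  have : CompactSpace (zeroLocus f) :=
    isCompact_iff_compactSpace.1 (isClosed_zeroLocus hf).isCompact
  have hc : Continuous fun x : zeroLocus f => twistorProj x.1 :=
    continuous_twistorProj.comp continuous_subtype_val
  refine .of_isLocalHomeomorphOn hc
    ((isLocalHomeomorphOn_iff_isOpenEmbedding_restrict _).2 fun x hreg => ?_)
  obtain ⟨w, hw0, hx⟩ : ∃ w, ∃ hw0 : w ≠ 0, Projectivization.mk ℂ w hw0 = x.1 :=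
    ⟨_, x.1.rep_nonzero, x.1.mk_rep⟩
  have hw := eval_eq_zero_of_mk_eq hf hx
  have hD : polyDeriv f w (jMap w) ≠ 0 :=
    IsRegular.polyDeriv_jMap_ne_zero hf ⟨hw0, by rwa [hx]⟩ hw
  refine exists_isOpenEmbedding_domRestrict hc ?_ (exists_injOn_twistorProj hf hx hD)
  filter_upwards [continuous_subtype_val.continuousAt.eventually
    (eventually_polyDeriv_ne_zero hx hD)] with y ⟨z, hz, hz0, hzy⟩
  exact nhds_twistorProj_le hf hzy hz

end Covering

theorem exists_norm_root_le {σ 𝕜 : Type*} [Finite σ] [RCLike 𝕜] {f : MvPolynomial σ 𝕜} {d : ℕ}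
    (hf : f.IsHomogeneous d) {y : σ → 𝕜} (hy : MvPolynomial.eval y f ≠ 0) {S : Set (σ → 𝕜)}
    (hS : Bornology.IsBounded S) :
    ∃ R, ∀ w ∈ S, ∀ a : 𝕜, MvPolynomial.eval (w + a • y) f = 0 → ‖a‖ ≤ R := by
  cases nonempty_fintype σ
  obtain ⟨M, hM⟩ := hS.exists_norm_le
  obtain ⟨ε, hε, hball⟩ := Metric.eventually_nhds_iff.1
    ((MvPolynomial.continuous_eval f).continuousAt.eventually_ne hy)
  refine ⟨max 0 (M / ε), fun w hw a ha => le_of_not_gt fun hlt => ?_⟩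
  have ha0 : 0 < ‖a‖ := (le_max_left ..).trans_lt hlt
  have hMa : M < ‖a‖ * ε := (div_lt_iff₀ hε).1 ((le_max_right ..).trans_lt hlt)
  refine hball (y := a⁻¹ • w + y) ?_ ?_
  · rw [dist_add_self_left, norm_smul, norm_inv, inv_mul_lt_iff₀ ha0]
    exact (hM w hw).trans_lt hMa
  · rw [← eval_smul_eq_zero_iff hf (norm_pos_iff.1 ha0), smul_add,
      smul_inv_smul₀ (norm_pos_iff.1 ha0), ha]

section Sheets

variable {f : MvPolynomial (Fin 4) ℂ} {d : ℕ}

theorem existsUnique_lift {A : Type*} [TopologicalSpace A] [SimplyConnectedSpace A]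
    [LocallyPathConnectedSpace A] (hf : f.IsHomogeneous d) {x : A → ℂ⁴} (hx : Continuous x)
    (hreg : ∀ a, IsRegular f d (x a)) {a₀ : A} {P : zeroLocus f}
    (hP : twistorProj P.1 = twistorProj (.mk ℂ (x a₀) (hreg a₀).1)) :
    ∃! s : C(A, zeroLocus f), s a₀ = P ∧
      ∀ a, twistorProj (s a).1 = twistorProj (.mk ℂ (x a) (hreg a).1) := by
  let b : C(A, HP1) := ⟨fun a => twistorProj (.mk ℂ (x a) (hreg a).1),
    continuous_twistorProj.comp (continuous_projectivization_mk hx _)⟩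
  have hb := (isCoveringMapOn_twistorProj hf).existsUnique_continuousMap_lifts b hP
    fun a => (hreg a).2
  simp only [funext_iff] at hb
  exact hb

variable {c : ℝ → ℂ⁴} {y : ℂ⁴}

theorem linearIndependent_of_add_smul_ne_zero {K V : Type*} [Field K] [AddCommGroup V] [Module K V]
    {w y : V} (hy : y ≠ 0) (h : ∀ a : K, w + a • y ≠ 0) : LinearIndependent K ![w, y] := by
  refine LinearIndependent.pair_symm_iff.1 ((LinearIndependent.pair_iff' hy).2 fun a ha => ?_)
  exact h (-a) (by rw [← ha, neg_smul, add_neg_cancel])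

/-- The sheet `s` over `(t, a) ↦ π [c t + a y]` passes through one of the points `[c t + a y]`. -/
def Meets (c : ℝ → ℂ⁴) (y : ℂ⁴) (s : C(ℝ × ℂ, zeroLocus f)) (t : ℝ) : Prop :=
  ∃ a, ∃ h : c t + a • y ≠ 0, Projectivization.mk ℂ (c t + a • y) h = (s (t, a)).1

theorem isClosed_setOf_meets (hf : f.IsHomogeneous d) (hc : Continuous c)
    (hfy : MvPolynomial.eval y f ≠ 0) (h0 : ∀ t (a : ℂ), c t + a • y ≠ 0)
    (s : C(ℝ × ℂ, zeroLocus f)) : IsClosed ({t | Meets c y s t} ∩ Set.Icc 0 1) := by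
  obtain ⟨R, hR⟩ := exists_norm_root_le hf hfy
    ((isCompact_Icc (a := (0 : ℝ)) (b := 1)).image hc).isBounded
  have hK : IsCompact
      ({v : ℝ × ℂ | Projectivization.mk ℂ (c v.1 + v.2 • y) (h0 v.1 v.2) = (s v).1} ∩
        Set.Icc 0 1 ×ˢ Metric.closedBall 0 R) := by
    refine (isCompact_Icc.prod (isCompact_closedBall 0 R)).inter_left (isClosed_eq ?_ ?_)
    · exact continuous_projectivization_mk (x := fun v : ℝ × ℂ => c v.1 + v.2 • y) (by fun_prop) _
    · exact continuous_subtype_val.comp s.continuous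
  convert (hK.image continuous_fst).isClosed using 1
  ext t
  constructor
  · rintro ⟨⟨a, h, ha⟩, ht⟩
    refine ⟨(t, a), ⟨ha, ht, mem_closedBall_zero_iff.2 (hR _ ⟨t, ht, rfl⟩ a ?_)⟩, rfl⟩
    exact eval_eq_zero_of_mk_eq hf ha
  · rintro ⟨⟨t, a⟩, ⟨ha, ht, -⟩, rfl⟩
    exact ⟨⟨a, _, ha⟩, ht⟩

theorem eventually_meets (hf : f.IsHomogeneous d) (hc : Continuous c)
    (hreg : ∀ t a, IsRegular f d (c t + a • y)) {s : C(ℝ × ℂ, zeroLocus f)}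
    (hs : ∀ v, twistorProj (s v).1 =
      twistorProj (.mk ℂ (c v.1 + v.2 • y) (hreg v.1 v.2).1)) {t₀ : ℝ} {a₀ : ℂ}
    {h0 : c t₀ + a₀ • y ≠ 0} (ha₀ : Projectivization.mk ℂ (c t₀ + a₀ • y) h0 = (s (t₀, a₀)).1)
    (hD : polyDeriv f (c t₀ + a₀ • y) y ≠ 0) : ∀ᶠ t in 𝓝 t₀, Meets c y s t := by
  have hroot := eval_eq_zero_of_mk_eq hf ha₀
  obtain ⟨ρ, hρ, hρ0, hev, -⟩ := exists_contDiffAt_root hroot hD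
  let a : ℝ → ℂ := fun t => a₀ + ρ (c t + a₀ • y, y)
  have hpair : ContinuousAt (fun t => (c t + a₀ • y, y)) t₀ := by fun_prop
  have ha : ContinuousAt a t₀ := continuousAt_const.add (hρ.continuousAt.comp_of_eq hpair rfl)
  have haa₀ : a t₀ = a₀ := by simp [a, hρ0]
  have hv : Tendsto (fun t => (t, a t)) (𝓝 t₀) (𝓝 (t₀, a₀)) := by
    rw [nhds_prod_eq, ← haa₀]
    exact tendsto_id.prodMk ha
  have hq : Continuous fun v : ℝ × ℂ =>
      Projectivization.mk ℂ (c v.1 + v.2 • y) (hreg v.1 v.2).1 :=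
    continuous_projectivization_mk (by fun_prop) _
  obtain ⟨U, hU, hinj⟩ := exists_injOn_twistorProj hf ha₀
    ((hreg t₀ a₀).polyDeriv_jMap_ne_zero hf hroot)
  obtain ⟨V, hV, hVU⟩ := (mem_nhds_subtype ..).1 hU
  have hsU := (s.continuous.continuousAt (x := (t₀, a₀))).tendsto.comp hv
  have hqV : ∀ᶠ t in 𝓝 t₀, Projectivization.mk ℂ (c t + a t • y) (hreg t (a t)).1 ∈ V :=
    (hq.continuousAt.tendsto.comp hv).eventually (ha₀ ▸ hV)
  filter_upwards [hsU hU, hqV, hpair.eventually hev] with t hst hqt hzero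
  have hzero' : MvPolynomial.eval (c t + a t • y) f = 0 := by
    rw [← hzero, add_smul, add_assoc]
  refine ⟨a t, (hreg t (a t)).1, congrArg Subtype.val (hinj
    (x₁ := ⟨_, (mk_mem_zeroLocus_iff hf _ _).2 hzero'⟩) (hVU hqt) hst (hs (t, a t)).symm)⟩

theorem exists_sheet (hf : f.IsHomogeneous d) (hc : Continuous c)
    (hreg : ∀ t a, IsRegular f d (c t + a • y)) (hy0 : y ∈ fibre (c 0)) {r : ℂ}
    (hr : MvPolynomial.eval (c 0 + r • y) f = 0) :
    ∃ s : C(ℝ × ℂ, zeroLocus f),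
      (∀ v, twistorProj (s v).1 =
        twistorProj (.mk ℂ (c v.1 + v.2 • y) (hreg v.1 v.2).1)) ∧
      ∀ a, (s (0, a)).1 = .mk ℂ (c 0 + r • y) (hreg 0 r).1 := by
  have hx : Continuous fun v : ℝ × ℂ => c v.1 + v.2 • y := by fun_prop
  let Q : zeroLocus f := ⟨.mk ℂ (c 0 + r • y) (hreg 0 r).1, (mk_mem_zeroLocus_iff hf _ _).2 hr⟩
  have hmem : ∀ a : ℂ, c 0 + a • y ∈ fibre (c 0) := fun a =>
    (fibre (c 0)).add_mem (self_mem_fibre _) ((fibre (c 0)).smul_mem a hy0)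
  have hfib : ∀ a : ℂ, twistorProj Q.1 = twistorProj (.mk ℂ (c 0 + a • y) (hreg 0 a).1) := by
    intro a
    rw [twistorProj_mk_eq_iff (hreg 0 a).1, fibre_eq_of_mem (hreg 0 a).1 (hmem a)]
    exact hmem r
  obtain ⟨s, ⟨hsr, hs⟩, -⟩ := existsUnique_lift hf (a₀ := ((0 : ℝ), r)) hx
    (fun v => hreg v.1 v.2) (hfib r)
  refine ⟨s, hs, fun a => ?_⟩
  have huniq := (existsUnique_lift hf (a₀ := r) (x := fun a => c 0 + a • y) (by fun_prop)
    (hreg 0) (hfib r)).unique (y₁ := s.comp ⟨fun a => (0, a), by fun_prop⟩) (y₂ := .const ℂ Q)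
    ⟨hsr, fun a => hs (0, a)⟩ ⟨rfl, hfib⟩
  exact congrArg Subtype.val (DFunLike.congr_fun huniq a)

theorem sheets_injective (hf : f.IsHomogeneous d) (hc : Continuous c)
    (hreg : ∀ t a, IsRegular f d (c t + a • y)) {ι : Type*} {s : ι → C(ℝ × ℂ, zeroLocus f)}
    (hs : ∀ r v, twistorProj (s r v).1 =
      twistorProj (.mk ℂ (c v.1 + v.2 • y) (hreg v.1 v.2).1)) (hinj : Function.Injective s)
    (v : ℝ × ℂ) : Function.Injective fun r => s r v := fun i j hij =>
  hinj ((existsUnique_lift hf (by fun_prop) (fun v => hreg v.1 v.2) (hs j v)).unique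
    ⟨hij, hs i⟩ ⟨rfl, hs j⟩)

theorem encard_le_of_meets (hf : f.IsHomogeneous d) {R : Set ℂ}
    {s : R → C(ℝ × ℂ, zeroLocus f)} (hinj : ∀ v, Function.Injective fun r => s r v) {t : ℝ}
    (ht : ∀ r, Meets c y (s r) t) :
    R.encard ≤ {a : ℂ | MvPolynomial.eval (c t + a • y) f = 0}.encard := by
  choose a h0 ha using ht
  refine ENat.card_le_card_of_injective
    (f := Set.codRestrict a _ fun r => eval_eq_zero_of_mk_eq hf (ha r)) fun i j hij => ?_
  have hij' : a i = a j := congrArg Subtype.val hij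
  refine hinj (t, a i) (Subtype.ext ?_)
  simp only [← ha i]
  simp only [hij', ← ha j]

theorem le_encard_roots (hf : f.IsHomogeneous d) (hc : Continuous c)
    (hreg : ∀ t (a : ℂ), IsRegular f d (c t + a • y)) (hfy : MvPolynomial.eval y f ≠ 0)
    (hy : y ≠ 0) (hy0 : y ∈ fibre (c 0)) :
    d ≤ {a : ℂ | MvPolynomial.eval (c 1 + a • y) f = 0}.encard := by
  have h0 : ∀ t (a : ℂ), c t + a • y ≠ 0 := fun t a => (hreg t a).1
  have hli : ∀ t, LinearIndependent ℂ ![c t, y] := fun t =>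
    linearIndependent_of_add_smul_ne_zero hy (h0 t)
  let R : Set ℂ := {a : ℂ | MvPolynomial.eval (c 0 + a • y) f = 0}
  have hcard : R.encard = d :=
    (isRegular_iff_encard hf (hli 0) hy0 hfy).1 (by simpa using hreg 0 0)
  have := (Set.finite_of_encard_eq_coe hcard).to_subtype
  choose s hs hs0 using fun r : R => exists_sheet hf hc hreg hy0 r.2
  have hinj := sheets_injective hf hc hreg hs fun i j hij => by
    have h := (hs0 i 0).symm.trans ((congrArg (fun s => (s (0, 0)).1) hij).trans (hs0 j 0))
    exact Subtype.ext (mk_add_smul_injective (hli 0) h)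
  let T : Set ℝ := {t | ∀ r, Meets c y (s r) t}
  have hT : ∀ t ∈ T, d ≤ {a : ℂ | MvPolynomial.eval (c t + a • y) f = 0}.encard := fun t ht =>
    hcard.symm.trans_le (encard_le_of_meets hf hinj ht)
  have hclosed : IsClosed (T ∩ Set.Icc 0 1) := by
    rcases isEmpty_or_nonempty R with hR | hR
    · simpa [T] using isClosed_Icc
    · simp only [T, Set.ofPred_forall, Set.iInter_inter]
      exact isClosed_iInter fun r => isClosed_setOf_meets hf hc hfy h0 (s r)
  refine hT 1 (hclosed.Icc_subset_of_forall_mem_nhdsWithin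
    (fun r => ⟨r, h0 0 r, (hs0 r r).symm⟩) (fun t ht => ?_) (Set.right_mem_Icc.2 zero_le_one))
  refine mem_nhdsWithin_of_mem_nhds (eventually_all.2 fun r => ?_)
  obtain ⟨a, h, ha⟩ := ht.1 r
  exact eventually_meets hf hc hreg (hs r) ha (polyDeriv_ne_zero_of_le_encard hf hfy (hT t ht.1)
    (eval_eq_zero_of_mk_eq hf ha))

end Sheets

section Tangent

theorem exists_forall_add_mul_notMem {B : Set (ℂ × ℂ)} (hB : B.Finite) (h0 : 0 ∉ B) {S : Set ℂ}
    (hS : S.Finite) : ∃ r ∉ S, ∃ ζ ≠ 0, ∀ (s : ℝ) (b : ℂ), (b, s * ζ + b * r) ∉ B := by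
  obtain ⟨r, hr⟩ := (hS.union (hB.image fun v => v.2 / v.1)).exists_notMem
  rw [Set.mem_union, not_or] at hr
  obtain ⟨k, hk⟩ := (hB.image fun v => (v.2 - v.1 * r).im / (v.2 - v.1 * r).re).exists_notMem
  refine ⟨r, hr.1, ⟨1, k⟩, fun h => one_ne_zero (congrArg Complex.re h), fun s b hb => ?_⟩
  have hs : s ≠ 0 := by
    rintro rfl
    simp only [Complex.ofReal_zero, zero_mul, zero_add] at hb
    have hb0 : b ≠ 0 := by
      rintro rfl
      exact h0 (by rwa [zero_mul] at hb)
    exact hr.2 ⟨_, hb, mul_div_cancel_left₀ r hb0⟩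
  refine hk ⟨_, hb, ?_⟩
  simp [hs]

variable {f : MvPolynomial (Fin 4) ℂ} {d : ℕ} {p e y₀ : ℂ⁴}

/-- The twistor lines, as planes in `ℂ⁴`, that do not meet the surface `{f = 0}` in exactly `d`
points. -/
def irregularFibres (f : MvPolynomial (Fin 4) ℂ) (d : ℕ) : Set (Submodule ℂ ℂ⁴) :=
  {F | ∃ z ≠ 0, ¬IsRegular f d z ∧ fibre z = F}

theorem fibre_mem_irregularFibres (hz0 : p ≠ 0) (hz : ¬IsRegular f d p) :
    fibre p ∈ irregularFibres f d :=
  ⟨p, hz0, hz, rfl⟩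

theorem finite_irregularFibres (hfin : (Disc d (zeroLocus f)).Finite) :
    (irregularFibres f d).Finite := by
  choose z hz0 hz using exists_twistorProj_mk_eq
  refine (hfin.image fun q => fibre (z q)).subset ?_
  rintro _ ⟨w, hw0, hw, rfl⟩
  refine ⟨twistorProj (.mk ℂ w hw0), by_contra fun h => hw ⟨hw0, h⟩, ?_⟩
  exact fibre_eq_of_mem (hz0 _) ((twistorProj_mk_eq_iff hw0 (hz0 _)).1 (hz _))

theorem eq_of_add_mem_fibre_add {φ : ℂ⁴ →ₗ[ℂ] ℂ} (hp : φ p = 0) (hjp : φ (jMap p) ≠ 0)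
    (he : fibre e ≤ φ.ker) {l m : ℂ⁴} (hl : l ∈ fibre e) (hm : m ∈ fibre e)
    (h : p + m ∈ fibre (p + l)) : l = m := by
  obtain ⟨a, b, hab⟩ := mem_fibre.1 h
  have hb : b = 0 := by
    have := congrArg φ hab
    simpa [hp, hjp, LinearMap.mem_ker.1 (he hl), LinearMap.mem_ker.1 (he hm),
      LinearMap.mem_ker.1 (he (jMap_mem_fibre hl))] using this
  have hpe : p ∉ fibre e := fun hpe => hjp (he (jMap_mem_fibre hpe))
  have ha : a = 1 := by
    by_contra ha
    refine hpe (((fibre e).smul_mem_iff (sub_ne_zero.2 ha)).1 ?_)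
    have : (a - 1) • p = m - a • l := by
      rw [hb] at hab
      linear_combination (norm := module) hab
    rw [this]
    exact (fibre e).sub_mem hm ((fibre e).smul_mem a hl)
  rw [ha, hb] at hab
  simpa using hab

theorem finite_setOf_not_isRegular_add (hfin : (Disc d (zeroLocus f)).Finite)
    {φ : ℂ⁴ →ₗ[ℂ] ℂ} (hp : φ p = 0) (hjp : φ (jMap p) ≠ 0) (he : fibre e ≤ φ.ker) :
    {l ∈ (fibre e : Set ℂ⁴) | ¬IsRegular f d (p + l)}.Finite := by
  refine Set.Finite.of_finite_image ((finite_irregularFibres hfin).subset ?_)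
    (f := fun l => fibre (p + l)) fun l hl m hm hlm => ?_
  · rintro _ ⟨l, ⟨hl, hreg⟩, rfl⟩
    refine fibre_mem_irregularFibres (fun h0 => hjp (he (jMap_mem_fibre ?_))) hreg
    rw [eq_neg_of_add_eq_zero_left h0]
    exact (fibre e).neg_mem hl
  · refine eq_of_add_mem_fibre_add hp hjp he hl.1 hm.1 ?_
    rw [show fibre (p + l) = fibre (p + m) from hlm]
    exact self_mem_fibre (p + m)

theorem isRegular_segment_add_smul (he : IsRegular f d e) (hy₀ : y₀ ∈ fibre e)
    (hey₀ : LinearIndependent ℂ ![e, y₀]) {r ζ : ℂ} (hζ : ζ ≠ 0)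
    (h : ∀ (s : ℝ) (b : ℂ), IsRegular f d (p + (b • e + (s * ζ + b * r) • y₀))) (t : ℝ) (a : ℂ) :
    IsRegular f d ((1 - t : ℂ) • ζ • y₀ + (t : ℂ) • p + a • (e + r • y₀)) := by
  rcases eq_or_ne (t : ℂ) 0 with ht | ht
  · have heq : (1 - t : ℂ) • ζ • y₀ + (t : ℂ) • p + a • (e + r • y₀) =
        a • e + (ζ + a * r) • y₀ := by
      rw [ht]
      module
    rw [heq]
    refine he.of_mem_fibre (fun h0 => hζ ?_) ((fibre e).add_mem
      ((fibre e).smul_mem a (self_mem_fibre e)) ((fibre e).smul_mem _ hy₀))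
    obtain ⟨ha, hb⟩ := LinearIndependent.pair_iff.1 hey₀ _ _ h0
    simpa [ha] using hb
  · have hreg := h ((1 - t) / t) (a / t)
    have heq : (1 - t : ℂ) • ζ • y₀ + (t : ℂ) • p + a • (e + r • y₀) =
        (t : ℂ) • (p + ((a / t) • e + (((1 - t) / t : ℝ) * ζ + a / t * r) • y₀)) := by
      push_cast
      match_scalars <;> field_simp
    rw [heq]
    exact hreg.of_mem_fibre (smul_ne_zero ht hreg.1) ((fibre _).smul_mem _ (self_mem_fibre _))

theorem not_isRegular_of_fibre_le_ker (hf : f.IsHomogeneous d)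
    (hfin : (Disc d (zeroLocus f)).Finite) (hp : IsRegular f d p)
    (hp0 : MvPolynomial.eval p f = 0) (he : fibre e ≤ (polyDeriv f p).ker) :
    ¬IsRegular f d e := by
  intro hreg
  obtain ⟨y₀, hy₀, hey₀, hfy₀⟩ := hreg.exists_eval_ne_zero hf
  have hpp : polyDeriv f p p = 0 := by rw [polyDeriv_self hf, hp0, mul_zero]
  have hmem : ∀ a b : ℂ, a • e + b • y₀ ∈ fibre e := fun a b =>
    (fibre e).add_mem ((fibre e).smul_mem a (self_mem_fibre e)) ((fibre e).smul_mem b hy₀)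
  let B : Set (ℂ × ℂ) := {v | ¬IsRegular f d (p + (v.1 • e + v.2 • y₀))}
  have hB : B.Finite := by
    refine Set.Finite.of_finite_image (f := fun v : ℂ × ℂ => v.1 • e + v.2 • y₀)
      ((finite_setOf_not_isRegular_add hfin hpp (hp.polyDeriv_jMap_ne_zero hf hp0) he).subset ?_)
      fun v _ w _ hvw => ?_
    · rintro _ ⟨v, hv, rfl⟩
      exact ⟨hmem _ _, hv⟩
    · exact Prod.ext_iff.2 (hey₀.eq_of_pair hvw)
  obtain ⟨r, hr, ζ, hζ, hrζ⟩ := exists_forall_add_mul_notMem hB (by simpa [B] using hp)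
    (finite_setOf_eval_add_smul_eq_zero hf e hfy₀)
  let y := e + r • y₀
  have hy : y ∈ fibre e := by simpa [y] using hmem 1 r
  refine polyDeriv_ne_zero_of_le_encard hf (w := p) (x := y) (t := 0) hr ?_ (by simpa using hp0)
    (by simpa using he hy)
  let c : ℝ → ℂ⁴ := fun t => (1 - t : ℂ) • ζ • y₀ + (t : ℂ) • p
  have hc : ∀ (t : ℝ) (a : ℂ), IsRegular f d (c t + a • y) :=
    isRegular_segment_add_smul hreg hy₀ hey₀ hζ fun s b => not_not.1 (hrζ s b)
  have hc0 : fibre (c 0) = fibre e := by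
    have hy₀0 : y₀ ≠ 0 := LinearIndependent.ne_zero 1 hey₀
    simpa [c] using fibre_eq_of_mem (smul_ne_zero hζ hy₀0) ((fibre e).smul_mem ζ hy₀)
  simpa [c] using le_encard_roots hf (by fun_prop) hc hr (add_smul_ne_zero hey₀ r) (hc0 ▸ hy)

end Tangent

section TangentDirection

variable {σ 𝕜 : Type*} [Finite σ] [RCLike 𝕜] {f : MvPolynomial σ 𝕜} {p x y : σ → 𝕜}

theorem deriv_root_eq_zero {ρ : 𝕜 → 𝕜} {s : 𝕜} (hρ : DifferentiableAt 𝕜 ρ s)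
    (h0 : ∀ᶠ t in 𝓝 s, MvPolynomial.eval (p + t • x + ρ t • y) f = 0)
    (hx : polyDeriv f (p + s • x + ρ s • y) x = 0)
    (hy : polyDeriv f (p + s • x + ρ s • y) y ≠ 0) : deriv ρ s = 0 := by
  cases nonempty_fintype σ
  have hγ : HasDerivAt (fun t => p + t • x + ρ t • y) (x + deriv ρ s • y) s := by
    simpa using (((hasDerivAt_id s).smul_const x).const_add p).fun_add (hρ.hasDerivAt.smul_const y)
  have hconst := (hasDerivAt_const s (0 : 𝕜)).congr_of_eventuallyEq h0
  have := ((hasFDerivAt_eval f _).comp_hasDerivAt s hγ).unique hconst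
  rw [map_add, map_smul, hx, zero_add, smul_eq_mul] at this
  exact (mul_eq_zero.1 this).resolve_right hy

theorem linePoly_eq_zero_of_eventually_tangent (hp : MvPolynomial.eval p f = 0)
    (hy : polyDeriv f p y ≠ 0)
    (hx : ∀ᶠ w in 𝓝 p, MvPolynomial.eval w f = 0 → polyDeriv f w x = 0) :
    linePoly f p x = 0 := by
  cases nonempty_fintype σ
  obtain ⟨ρ, hρ, hρ0, hρf, -⟩ := exists_contDiffAt_root hp hy
  let c : 𝕜 → 𝕜 := fun s => ρ (p + s • x, y)
  have hc0 : c 0 = 0 := by simpa [c] using hρ0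
  have hline : ContDiffAt 𝕜 1 (fun s : 𝕜 => (p + s • x, y)) 0 := by fun_prop
  have hp0 : (p + (0 : 𝕜) • x, y) = (p, y) := by simp
  have hc : ContDiffAt 𝕜 1 c 0 := (hp0 ▸ hρ).comp 0 hline
  have hγ : ContinuousAt (fun s => p + s • x + c s • y) 0 := by
    have := hc.continuousAt
    fun_prop
  have hγ0 : p + (0 : 𝕜) • x + c 0 • y = p := by simp [hc0]
  rw [ContinuousAt, hγ0] at hγ
  have hroot : ∀ᶠ s in 𝓝 (0 : 𝕜), MvPolynomial.eval (p + s • x + c s • y) f = 0 :=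
    hline.continuousAt.eventually (hp0 ▸ hρf)
  have hderiv : ∀ᶠ s in 𝓝 (0 : 𝕜), MvPolynomial.eval (p + s • x + c s • y) f = 0 ∧
      DifferentiableAt 𝕜 c s ∧ deriv c s = 0 := by
    filter_upwards [hroot.eventually_nhds, (hc.eventually (by simp)), hγ.eventually hx,
      hγ.eventually ((continuous_polyDeriv_apply f y).continuousAt.eventually_ne hy)]
      with s hs hcs hxs hys
    have hcs := hcs.differentiableAt one_ne_zero
    exact ⟨hs.self_of_nhds, hcs, deriv_root_eq_zero hcs hs (hxs hs.self_of_nhds) hys⟩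
  obtain ⟨r, hr, hball⟩ := Metric.eventually_nhds_iff_ball.1 hderiv
  refine Polynomial.eq_zero_of_infinite_isRoot _ (Set.Infinite.mono (s := Metric.ball (0 : 𝕜) r)
    (fun t ht => ?_) (infinite_of_mem_nhds 0 (Metric.ball_mem_nhds 0 hr)))
  have hct : c t = 0 := by
    rw [← hc0]
    exact Metric.isOpen_ball.is_const_of_deriv_eq_zero (convex_ball _ _).isPreconnected
      (fun s hs => (hball s hs).2.1.differentiableWithinAt) (fun s hs => (hball s hs).2.2) ht
      (Metric.mem_ball_self hr)
  have := (hball t ht).1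
  rw [hct, zero_smul, add_zero] at this
  rwa [Set.mem_ofPred_eq, Polynomial.IsRoot, eval_linePoly]

end TangentDirection

section TangentPlane

variable {f : MvPolynomial (Fin 4) ℂ} {d : ℕ} {p z : ℂ⁴}

theorem eventually_isRegular (hfin : (Disc d (zeroLocus f)).Finite) (hp : IsRegular f d p) :
    ∀ᶠ z in 𝓝 p, IsRegular f d z := by
  have hF : ∀ᶠ z in 𝓝 p, ∀ F ∈ irregularFibres f d, z ∉ F := by
    rw [eventually_all_finite (finite_irregularFibres hfin)]
    rintro _ ⟨w, hw0, hw, rfl⟩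
    refine (fibre w).closed_of_finiteDimensional.isOpen_compl.mem_nhds fun hpw => hw ?_
    exact hp.of_mem_fibre hw0 (fibre_eq_of_mem hp.1 hpw ▸ self_mem_fibre w)
  filter_upwards [hF, isOpen_ne.mem_nhds hp.1] with z hz hz0
  exact by_contra fun h => hz _ (fibre_mem_irregularFibres hz0 h) (self_mem_fibre z)

theorem eventually_not_le_ker {F : Submodule ℂ ℂ⁴} (hF : ¬F ≤ (polyDeriv f p).ker) :
    ∀ᶠ z in 𝓝 p, ¬F ≤ (polyDeriv f z).ker := by
  obtain ⟨v, hv, hpv⟩ := SetLike.not_le_iff_exists.1 hF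
  filter_upwards [(continuous_polyDeriv_apply f v).continuousAt.eventually_ne hpv] with z hz hle
  exact hz (hle hv)

theorem exists_eventually_fibre_le_ker (hf : f.IsHomogeneous d)
    (hfin : (Disc d (zeroLocus f)).Finite) (hp : IsRegular f d p)
    (hp0 : MvPolynomial.eval p f = 0) : ∃ e ≠ 0,
    ∀ᶠ z in 𝓝 p, MvPolynomial.eval z f = 0 → fibre e ≤ (polyDeriv f z).ker := by
  obtain ⟨e, he0, he⟩ := exists_fibre_le_ker (polyDeriv f p : ℂ⁴ →ₗ[ℂ] ℂ)
  have hφ : (polyDeriv f p : ℂ⁴ →ₗ[ℂ] ℂ) ≠ 0 := fun h =>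
    hp.polyDeriv_jMap_ne_zero hf hp0 (LinearMap.congr_fun h _)
  have hev : ∀ᶠ z in 𝓝 p, ∀ F ∈ irregularFibres f d, F ≠ fibre e →
      ¬F ≤ (polyDeriv f z).ker := by
    rw [eventually_all_finite (finite_irregularFibres hfin)]
    rintro _ ⟨w, hw0, -, rfl⟩
    rw [eventually_imp_distrib_left]
    exact fun hne => eventually_not_le_ker fun hw => hne (fibre_eq_of_le_ker hφ hw0 he0 hw he)
  refine ⟨e, he0, ?_⟩
  filter_upwards [hev, eventually_isRegular hfin hp] with z hz hreg hz0
  obtain ⟨w, hw0, hw⟩ := exists_fibre_le_ker (polyDeriv f z : ℂ⁴ →ₗ[ℂ] ℂ)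
  have hwF := fibre_mem_irregularFibres hw0 (not_isRegular_of_fibre_le_ker hf hfin hreg hz0 hw)
  have hwe : fibre w = fibre e := by_contra fun hne => hz _ hwF hne hw
  exact hwe ▸ hw

theorem exists_smul_add_eq_of_mem_ker {φ : ℂ⁴ →ₗ[ℂ] ℂ} (hp : φ p = 0) (hjp : φ (jMap p) ≠ 0)
    {e : ℂ⁴} (he0 : e ≠ 0) (he : fibre e ≤ φ.ker) (hz : φ z = 0) :
    ∃ c : ℂ, ∃ x ∈ fibre e, c • p + x = z := by
  let c := star (φ (jMap z) / φ (jMap p))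
  refine ⟨c, z - c • p, ?_, add_sub_cancel _ _⟩
  rcases eq_or_ne (z - c • p) 0 with h0 | h0
  · exact h0 ▸ (fibre e).zero_mem
  have hφ : φ ≠ 0 := fun h => hjp (by rw [h, LinearMap.zero_apply])
  refine fibre_eq_of_le_ker hφ h0 he0 (fibre_le_iff.2 ⟨?_, ?_⟩) he ▸ self_mem_fibre _
  · simp [hz, hp]
  · simp [c, map_smulₛₗ, hjp]

theorem eval_eq_zero_of_polyDeriv_eq_zero (hf : f.IsHomogeneous d)
    (hfin : (Disc d (zeroLocus f)).Finite) (hp : IsRegular f d p)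
    (hp0 : MvPolynomial.eval p f = 0) (hz : polyDeriv f p z = 0) :
    MvPolynomial.eval z f = 0 := by
  obtain ⟨e, he0, he⟩ := exists_eventually_fibre_le_ker hf hfin hp hp0
  have hpp : polyDeriv f p p = 0 := by rw [polyDeriv_self hf, hp0, mul_zero]
  have hjp := hp.polyDeriv_jMap_ne_zero hf hp0
  obtain ⟨c, x, hx, rfl⟩ := exists_smul_add_eq_of_mem_ker (φ := (polyDeriv f p : ℂ⁴ →ₗ[ℂ] ℂ))
    hpp hjp he0 (he.self_of_nhds hp0) hz
  have hline := linePoly_eq_zero_of_eventually_tangent hp0 hjp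
    (he.mono fun w hw hw0 => hw hw0 hx)
  rcases eq_or_ne c 0 with rfl | hc
  · rw [zero_smul, zero_add, ← coeff_linePoly hf p x, hline, Polynomial.coeff_zero]
  · rw [← smul_inv_smul₀ hc x, ← smul_add, eval_smul_eq_zero_iff hf hc, ← eval_linePoly, hline,
      Polynomial.eval_zero]

end TangentPlane

section Hyperplanes

variable {φ ψ : ℂ⁴ →ₗ[ℂ] ℂ} {e : ℂ⁴}

theorem ker_sup_ker_eq_top (hφ : φ ≠ 0) (hψ : ψ ≠ 0) (h : φ.ker ≠ ψ.ker) :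
    φ.ker ⊔ ψ.ker = ⊤ :=
  (LinearMap.isCoatom_ker_of_surjective (LinearMap.surjective hφ)).sup_eq_top_of_ne
    (LinearMap.isCoatom_ker_of_surjective (LinearMap.surjective hψ)) h

theorem finrank_ker_inf_ker (hφ : φ ≠ 0) (hψ : ψ ≠ 0) (h : φ.ker ≠ ψ.ker) :
    finrank ℂ ↥(φ.ker ⊓ ψ.ker) = 2 := by
  have hsum := Submodule.finrank_sup_add_finrank_inf_eq φ.ker ψ.ker
  have h1 := Dual.finrank_ker_add_one_of_ne_zero hφ
  have h2 := Dual.finrank_ker_add_one_of_ne_zero hψ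
  rw [ker_sup_ker_eq_top hφ hψ h, finrank_top] at hsum
  simp only [finrank_fin_fun] at hsum h1 h2
  omega

theorem ker_inf_ker_eq_fibre (hφ : φ ≠ 0) (hψ : ψ ≠ 0) (h : φ.ker ≠ ψ.ker) (he0 : e ≠ 0)
    (heφ : fibre e ≤ φ.ker) (heψ : fibre e ≤ ψ.ker) : φ.ker ⊓ ψ.ker = fibre e :=
  (Submodule.eq_of_le_of_finrank_eq (le_inf heφ heψ)
    ((finrank_fibre he0).trans (finrank_ker_inf_ker hφ hψ h).symm)).symm

end Hyperplanes

section PlanesInSurface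

variable {f : MvPolynomial (Fin 4) ℂ} {d : ℕ} {φ ψ : ℂ⁴ →ₗ[ℂ] ℂ} {e : ℂ⁴}

theorem exists_le_of_forall_not_isRegular (hfin : (Disc d (zeroLocus f)).Finite)
    {W : Submodule ℂ ℂ⁴} (hW : W ≠ ⊥) (h : ∀ w ∈ W, ¬IsRegular f d w) :
    ∃ F ∈ irregularFibres f d, W ≤ F := by
  have := (finite_irregularFibres hfin).to_subtype
  have hcover : ⋃ F : irregularFibres f d, (F.1.comap W.subtype : Set W) = Set.univ := by
    rw [Set.eq_univ_iff_forall]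
    intro w
    obtain ⟨v, hv, hv0⟩ : ∃ v ∈ W, v ≠ 0 ∧ (w : ℂ⁴) ∈ fibre v := by
      rcases eq_or_ne (w : ℂ⁴) 0 with hw | hw
      · obtain ⟨v, hv, hv0⟩ := W.ne_bot_iff.1 hW
        exact ⟨v, hv, hv0, hw ▸ (fibre v).zero_mem⟩
      · exact ⟨w, w.2, hw, self_mem_fibre _⟩
    exact Set.mem_iUnion.2 ⟨⟨_, fibre_mem_irregularFibres hv0.1 (h v hv)⟩, hv0.2⟩
  obtain ⟨F, hF⟩ := Subspace.exists_eq_top_of_iUnion_eq_univ hcover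
  exact ⟨F, F.2, Submodule.comap_subtype_eq_top.1 hF⟩

theorem exists_isRegular (hfin : (Disc d (zeroLocus f)).Finite) : ∃ z, IsRegular f d z := by
  by_contra! h
  obtain ⟨_, ⟨z, hz0, -, rfl⟩, htop⟩ :=
    exists_le_of_forall_not_isRegular hfin top_ne_bot fun z _ => h z
  have := finrank_fibre hz0
  rw [top_le_iff.1 htop] at this
  simp at this

theorem le_ker_polyDeriv {S : Submodule ℂ ℂ⁴} (hS : ∀ z ∈ S, MvPolynomial.eval z f = 0) {w : ℂ⁴}
    (hw : w ∈ S) : S ≤ (polyDeriv f w).ker := by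
  intro x hx
  have hline : HasDerivAt (fun t : ℂ => MvPolynomial.eval (w + t • x) f) 0 0 := by
    simp only [fun t : ℂ => hS _ (S.add_mem hw (S.smul_mem t hx))]
    exact hasDerivAt_const 0 0
  simpa using (hasDerivAt_eval_line f w x 0).unique hline

theorem not_isRegular_of_mem_ker_inf_ker (hf : f.IsHomogeneous d) (hφ : φ ≠ 0) (hψ : ψ ≠ 0)
    (h : φ.ker ≠ ψ.ker) (hφf : ∀ z ∈ φ.ker, MvPolynomial.eval z f = 0)
    (hψf : ∀ z ∈ ψ.ker, MvPolynomial.eval z f = 0) {w : ℂ⁴} (hw : w ∈ φ.ker ⊓ ψ.ker) :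
    ¬IsRegular f d w := by
  intro hreg
  have htop := sup_le (le_ker_polyDeriv hφf hw.1) (le_ker_polyDeriv hψf hw.2)
  rw [ker_sup_ker_eq_top hφ hψ h] at htop
  exact hreg.polyDeriv_jMap_ne_zero hf (hφf w hw.1) (htop Submodule.mem_top)

theorem fibre_le_ker_of_fibre_le_ker (hf : f.IsHomogeneous d)
    (hfin : (Disc d (zeroLocus f)).Finite) (hφ : φ ≠ 0) (hψ : ψ ≠ 0)
    (hφf : ∀ z ∈ φ.ker, MvPolynomial.eval z f = 0) (hψf : ∀ z ∈ ψ.ker, MvPolynomial.eval z f = 0)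
    (he0 : e ≠ 0) (he : fibre e ≤ φ.ker) : fibre e ≤ ψ.ker := by
  rcases eq_or_ne φ.ker ψ.ker with h | h
  · exact h ▸ he
  have hrank := finrank_ker_inf_ker hφ hψ h
  obtain ⟨_, ⟨w, hw0, -, rfl⟩, hle⟩ := exists_le_of_forall_not_isRegular hfin
    (Submodule.one_le_finrank_iff.1 (hrank.symm ▸ one_le_two))
    fun w hw => not_isRegular_of_mem_ker_inf_ker hf hφ hψ h hφf hψf hw
  have hw : φ.ker ⊓ ψ.ker = fibre w :=
    Submodule.eq_of_le_of_finrank_eq hle (hrank.trans (finrank_fibre hw0).symm)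
  rw [fibre_eq_of_le_ker hφ he0 hw0 he (hw ▸ inf_le_left), ← hw]
  exact inf_le_right

theorem exists_mem_ker_of_eval_eq_zero (hf : f.IsHomogeneous d) {φ : Fin d → ℂ⁴ →ₗ[ℂ] ℂ}
    (hφ : ∀ i, φ i ≠ 0) (hinj : Function.Injective fun i => (φ i).ker)
    (hφf : ∀ i, ∀ z ∈ (φ i).ker, MvPolynomial.eval z f = 0) (he0 : e ≠ 0)
    (he : ∀ i, fibre e ≤ (φ i).ker) {y : ℂ⁴} (hy : IsRegular f d y) (hey : fibre e ≠ fibre y)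
    {z : ℂ⁴} (hz : MvPolynomial.eval z f = 0) (hze : z ∉ fibre e) : ∃ i, z ∈ (φ i).ker := by
  by_contra! hzφ
  obtain ⟨l, hl, m, hm, rfl⟩ : ∃ l ∈ fibre e, ∃ m ∈ fibre y, l + m = z :=
    Submodule.mem_sup.1 (fibre_sup_fibre he0 hy.1 hey ▸ Submodule.mem_top)
  have hm0 : m ≠ 0 := by
    rintro rfl
    exact hze (by simpa using hl)
  obtain ⟨x, hx, hmx, hfx⟩ := (hy.of_mem_fibre hm0 hm).exists_eval_ne_zero hf
  rw [fibre_eq_of_mem hm0 hm] at hx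
  have hφx : ∀ i, φ i x ≠ 0 := fun i h => hfx (hφf i x h)
  let t : Fin d → ℂ := fun i => -(φ i (l + m) / φ i x)
  have ht : ∀ i, l + m + t i • x ∈ (φ i).ker := fun i => by
    rw [LinearMap.mem_ker, map_add _ (l + m), map_smul, smul_eq_mul, neg_mul,
      div_mul_cancel₀ _ (hφx i), add_neg_cancel]
  have ht_inj : Function.Injective t := by
    intro i k hik
    by_contra hne
    have hmem : l + m + t i • x ∈ fibre e :=
      ker_inf_ker_eq_fibre (hφ i) (hφ k) (hinj.ne hne) he0 (he i) (he k) ▸ ⟨ht i, hik ▸ ht k⟩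
    rw [add_assoc, Submodule.add_mem_iff_right _ hl] at hmem
    exact add_smul_ne_zero hmx (t i) (Submodule.disjoint_def.1 (disjoint_fibre hey) _ hmem
      ((fibre y).add_mem hm ((fibre y).smul_mem _ hx)))
  have ht0 : (0 : ℂ) ∉ Set.range t := by
    rintro ⟨i, hi⟩
    exact hzφ i (by simpa [hi] using ht i)
  refine linePoly_ne_zero hf (l + m) hfx
    (Polynomial.eq_zero_of_natDegree_lt_card_of_eval_eq_zero _
      (Fin.cons_injective_iff.2 ⟨ht0, ht_inj⟩) ?_
      (by simpa using Nat.lt_succ_of_le (natDegree_linePoly_le hf (l + m) x)))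
  refine Fin.forall_fin_succ.2 ⟨?_, fun i => ?_⟩
  · simpa [eval_linePoly] using hz
  · simpa only [eval_linePoly, Fin.cons_succ] using hφf i _ (ht i)

end PlanesInSurface

section TangentPlanes

variable {f : MvPolynomial (Fin 4) ℂ} {d : ℕ}

theorem exists_injective_range_roots {x y : ℂ⁴} (hf : f.IsHomogeneous d) (hx : IsRegular f d x)
    (hy : y ∈ fibre x) (hxy : LinearIndependent ℂ ![x, y]) (hfy : MvPolynomial.eval y f ≠ 0) :
    ∃ t : Fin d → ℂ, Function.Injective t ∧
      Set.range t = {a | MvPolynomial.eval (x + a • y) f = 0} := by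
  have hcard := (isRegular_iff_encard hf hxy hy hfy).1 hx
  obtain ⟨n, t, ht, hrange⟩ := (Set.finite_of_encard_eq_coe hcard).fin_param
  rw [← hrange, ← Set.image_univ, ht.encard_image, Set.encard_univ,
    ENat.card_eq_coe_fintype_card, Fintype.card_fin, Nat.cast_inj] at hcard
  subst hcard
  exact ⟨t, ht, hrange⟩

theorem exists_planes_in_zeroSet (hf : f.IsHomogeneous d)
    (hfin : (Disc d (zeroLocus f)).Finite) :
    ∃ φ : Fin d → ℂ⁴ →ₗ[ℂ] ℂ, (∀ i, φ i ≠ 0) ∧ (Function.Injective fun i => (φ i).ker) ∧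
      ∀ i, ∀ z ∈ (φ i).ker, MvPolynomial.eval z f = 0 := by
  obtain ⟨x, hx⟩ := exists_isRegular hfin
  obtain ⟨y, hy, hxy, hfy⟩ := hx.exists_eval_ne_zero hf
  obtain ⟨t, ht, hroots⟩ := exists_injective_range_roots hf hx hy hxy hfy
  have hp : ∀ i, MvPolynomial.eval (x + t i • y) f = 0 := fun i => hroots.le ⟨i, rfl⟩
  have hreg : ∀ i, IsRegular f d (x + t i • y) := fun i =>
    hx.of_mem_fibre (add_smul_ne_zero hxy _)
      ((fibre x).add_mem (self_mem_fibre x) ((fibre x).smul_mem _ hy))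
  let φ : Fin d → ℂ⁴ →ₗ[ℂ] ℂ := fun i => polyDeriv f (x + t i • y)
  have hφp : ∀ i, φ i (x + t i • y) = 0 := fun i => by
    simp [φ, polyDeriv_self hf, hp]
  have hφy : ∀ i, φ i y ≠ 0 := fun i => polyDeriv_ne_zero_of_le_encard hf hfy
    ((isRegular_iff_encard hf hxy hy hfy).1 hx).ge (hp i)
  refine ⟨φ, fun i h => hφy i (by rw [h, LinearMap.zero_apply]), fun i k hik => ?_, fun i z hz =>
    eval_eq_zero_of_polyDeriv_eq_zero hf hfin (hreg i) (hp i) hz⟩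
  have hk : φ k (x + t i • y) = 0 := (congrArg (x + t i • y ∈ ·) hik).mp (hφp i)
  have hdiff : (t i - t k) * φ k y = φ k (x + t i • y) - φ k (x + t k • y) := by
    simp only [map_add, map_smul, smul_eq_mul]
    ring
  rw [hk, hφp, sub_zero, mul_eq_zero, or_iff_left (hφy k)] at hdiff
  exact ht (sub_eq_zero.1 hdiff)

theorem exists_planes_through_fibre (hf : f.IsHomogeneous d) (hd : 1 ≤ d)
    (hfin : (Disc d (zeroLocus f)).Finite) :
    ∃ φ : Fin d → ℂ⁴ →ₗ[ℂ] ℂ, (∀ i, φ i ≠ 0) ∧ (Function.Injective fun i => (φ i).ker) ∧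
      (∃ e ≠ 0, ∀ i, fibre e ≤ (φ i).ker) ∧
      ∀ z, MvPolynomial.eval z f = 0 ↔ ∃ i, z ∈ (φ i).ker := by
  obtain ⟨φ, hφ, hinj, hφf⟩ := exists_planes_in_zeroSet hf hfin
  let i₀ : Fin d := ⟨0, hd⟩
  obtain ⟨e, he0, he₀⟩ := exists_fibre_le_ker (φ i₀)
  have he : ∀ i, fibre e ≤ (φ i).ker := fun i =>
    fibre_le_ker_of_fibre_le_ker hf hfin (hφ i₀) (hφ i) (hφf i₀) (hφf i) he0 he₀
  refine ⟨φ, hφ, hinj, ⟨e, he0, he⟩, fun z => ⟨fun hz => ?_, fun ⟨i, hi⟩ => hφf i z hi⟩⟩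
  by_cases hze : z ∈ fibre e
  · exact ⟨i₀, he₀ hze⟩
  obtain ⟨y, hy⟩ := exists_isRegular hfin
  have hey : fibre e ≠ fibre y := by
    intro h
    obtain ⟨w, hw, -, hfw⟩ := hy.exists_eval_ne_zero hf
    exact hfw (hφf i₀ w (he₀ (h ▸ hw)))
  exact exists_mem_ker_of_eval_eq_zero hf hφ hinj hφf he0 he hy hey hz hze

end TangentPlanes

section Planes

variable {φ ψ : ℂ⁴ →ₗ[ℂ] ℂ} {e z : ℂ⁴}

/-- The plane `{φ = 0} ⊆ ℂℙ³` cut out by a linear form `φ`. -/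
def kerPlane (φ : ℂ⁴ →ₗ[ℂ] ℂ) : Set CP3 := {p | φ p.rep = 0}

theorem mk_mem_kerPlane {hz : z ≠ 0} : Projectivization.mk ℂ z hz ∈ kerPlane φ ↔ z ∈ φ.ker := by
  obtain ⟨a, ha⟩ := Projectivization.exists_smul_eq_mk_rep ℂ z hz
  rw [kerPlane, Set.mem_ofPred_eq, ← ha, Units.smul_def, map_smul, smul_eq_zero,
    or_iff_right a.ne_zero, LinearMap.mem_ker]

theorem kerPlane_inj : kerPlane φ = kerPlane ψ ↔ φ.ker = ψ.ker := by
  constructor <;> intro h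
  · ext z
    rcases eq_or_ne z 0 with rfl | hz
    · simp
    · rw [← mk_mem_kerPlane (hz := hz), h, mk_mem_kerPlane]
  · ext p
    induction p using Projectivization.ind with
    | h z hz => rw [mk_mem_kerPlane, h, mk_mem_kerPlane]

theorem twistorLine_subset_kerPlane_iff {he : e ≠ 0} :
    twistorProj ⁻¹' {twistorProj (.mk ℂ e he)} ⊆ kerPlane φ ↔ fibre e ≤ φ.ker := by
  constructor
  · intro h z hz
    rcases eq_or_ne z 0 with rfl | hz0
    · exact φ.ker.zero_mem
    · exact (mk_mem_kerPlane (hz := hz0)).1 (h ((twistorProj_mk_eq_iff he hz0).2 hz))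
  · intro h p hp
    induction p using Projectivization.ind with
    | h z hz => exact mk_mem_kerPlane.2 (h ((twistorProj_mk_eq_iff he hz).1 hp))

theorem eval_eq_polyDeriv_zero {l : MvPolynomial (Fin 4) ℂ} (hl : l.IsHomogeneous 1) (z : ℂ⁴) :
    MvPolynomial.eval z l = polyDeriv l 0 z := by
  have h := hasDerivAt_eval_line l 0 z 0
  simp only [zero_add, zero_smul, eval_smul hl, pow_one] at h
  exact (hasDerivAt_mul_const _).unique h

theorem isPlane_iff {H : Set CP3} : IsPlane H ↔ ∃ φ : ℂ⁴ →ₗ[ℂ] ℂ, φ ≠ 0 ∧ H = kerPlane φ := by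
  constructor
  · rintro ⟨l, hl0, hl, rfl⟩
    refine ⟨polyDeriv l 0, fun h => hl0 (MvPolynomial.funext fun z => ?_), ?_⟩
    · rw [eval_eq_polyDeriv_zero hl, map_zero]
      exact LinearMap.congr_fun h z
    · ext p
      exact (eval_eq_polyDeriv_zero hl p.rep).congr_left
  · rintro ⟨φ, hφ, rfl⟩
    let l : MvPolynomial (Fin 4) ℂ := ∑ i, MvPolynomial.C (φ (Pi.single i 1)) * MvPolynomial.X i
    have hl : ∀ z, MvPolynomial.eval z l = φ z := fun z => by
      rw [LinearMap.pi_apply_eq_sum_univ φ z, map_sum]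
      refine Finset.sum_congr rfl fun i _ => ?_
      rw [map_mul, MvPolynomial.eval_C, MvPolynomial.eval_X, mul_comm, smul_eq_mul]
      congr 2
      funext k
      simp only [Pi.single_apply, eq_comm]
    refine ⟨l, fun h0 => hφ (LinearMap.ext fun z => ?_),
      MvPolynomial.IsHomogeneous.sum _ _ _ fun i _ => MvPolynomial.isHomogeneous_C_mul_X _ i, ?_⟩
    · rw [← hl, h0, map_zero, LinearMap.zero_apply]
    · ext p
      exact (hl p.rep).symm.congr_left

end Planes

section DiscOfPlanes

variable {φ : ℂ⁴ →ₗ[ℂ] ℂ} {e z : ℂ⁴}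

theorem infinite_twistorLine (he : e ≠ 0) :
    (twistorProj ⁻¹' {twistorProj (.mk ℂ e he)}).Infinite := by
  refine (Set.infinite_range_of_injective
    (mk_add_smul_injective (linearIndependent_jMap he))).mono ?_
  rintro _ ⟨t, rfl⟩
  exact (twistorProj_mk_eq_iff he _).2 ((fibre e).add_mem (self_mem_fibre e)
    ((fibre e).smul_mem t (jMap_mem_fibre (self_mem_fibre e))))

theorem finrank_fibre_inf_ker (hz : z ≠ 0) (h : ¬fibre z ≤ φ.ker) :
    finrank ℂ ↥(fibre z ⊓ φ.ker) = 1 := by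
  have hφ : φ ≠ 0 := by
    rintro rfl
    simp at h
  have htop : fibre z ⊔ φ.ker = ⊤ := by
    rw [sup_comm]
    exact (LinearMap.isCoatom_ker_of_surjective (LinearMap.surjective hφ)).2 _
      (left_lt_sup.2 h)
  have hsum := Submodule.finrank_sup_add_finrank_inf_eq (fibre z) φ.ker
  have hker := Dual.finrank_ker_add_one_of_ne_zero hφ
  rw [htop, finrank_top, finrank_fibre hz] at hsum
  simp only [finrank_fin_fun] at hsum hker
  omega

theorem exists_twistorLine_inter_kerPlane_eq (hz : z ≠ 0) (h : ¬fibre z ≤ φ.ker) :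
    ∃ p, twistorProj ⁻¹' {twistorProj (.mk ℂ z hz)} ∩ kerPlane φ = {p} := by
  obtain ⟨⟨v, hvz, hvφ⟩, hv0, hv⟩ := finrank_eq_one_iff'.1 (finrank_fibre_inf_ker hz h)
  have hv0 : v ≠ 0 := fun h0 => hv0 (Subtype.ext h0)
  refine ⟨.mk ℂ v hv0, ?_⟩
  ext p
  induction p using Projectivization.ind with
  | h w hw =>
    rw [Set.mem_inter_iff, mk_mem_kerPlane, Set.mem_singleton_iff, Projectivization.mk_eq_mk_iff']
    constructor
    · rintro ⟨hwz, hwφ⟩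
      obtain ⟨c, hc⟩ := hv ⟨w, (twistorProj_mk_eq_iff hz hw).1 hwz, hwφ⟩
      exact ⟨c, congrArg Subtype.val hc⟩
    · rintro ⟨c, rfl⟩
      exact ⟨(twistorProj_mk_eq_iff hz hw).2 ((fibre z).smul_mem c hvz), φ.ker.smul_mem c hvφ⟩

theorem encard_twistorLine_inter_iUnion_kerPlane {d : ℕ} {φ : Fin d → ℂ⁴ →ₗ[ℂ] ℂ}
    (hφ : ∀ i, φ i ≠ 0) (hinj : Function.Injective fun i => (φ i).ker) (he0 : e ≠ 0)
    (he : ∀ i, fibre e ≤ (φ i).ker) (hz : z ≠ 0) (hze : z ∉ fibre e) :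
    (twistorProj ⁻¹' {twistorProj (.mk ℂ z hz)} ∩ ⋃ i, kerPlane (φ i)).encard = d := by
  have hne : fibre e ≠ fibre z := fun h => hze (h ▸ self_mem_fibre z)
  choose p hp using fun i => exists_twistorLine_inter_kerPlane_eq hz fun h =>
    hne (fibre_eq_of_le_ker (hφ i) he0 hz (he i) h)
  have hp_inj : Function.Injective p := by
    intro i k hik
    by_contra hne'
    have hi : p i ∈ _ ∩ _ := (hp i).ge rfl
    have hk : p k ∈ _ ∩ _ := (hp k).ge rfl
    rw [← hik] at hk
    generalize p i = x at hi hk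
    induction x using Projectivization.ind with
    | h w hw =>
      have hwe : w ∈ fibre e :=
        ker_inf_ker_eq_fibre (hφ i) (hφ k) (hinj.ne hne') he0 (he i) (he k) ▸
          ⟨mk_mem_kerPlane.1 hi.2, mk_mem_kerPlane.1 hk.2⟩
      exact hw (Submodule.disjoint_def.1 (disjoint_fibre hne) w hwe
        ((twistorProj_mk_eq_iff hz hw).1 hi.1))
  simp only [Set.inter_iUnion, hp, Set.iUnion_singleton_eq_range]
  rw [← Set.image_univ, hp_inj.encard_image, Set.encard_univ, ENat.card_eq_coe_fintype_card,
    Fintype.card_fin]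

theorem disc_iUnion_kerPlane {d : ℕ} (hd : 1 ≤ d) {φ : Fin d → ℂ⁴ →ₗ[ℂ] ℂ} (hφ : ∀ i, φ i ≠ 0)
    (hinj : Function.Injective fun i => (φ i).ker) (he0 : e ≠ 0)
    (he : ∀ i, fibre e ≤ (φ i).ker) :
    Disc d (⋃ i, kerPlane (φ i)) = {twistorProj (.mk ℂ e he0)} := by
  ext q
  obtain ⟨z, hz, rfl⟩ := exists_twistorProj_mk_eq q
  rw [Set.mem_singleton_iff, twistorProj_mk_eq_iff he0 hz]
  constructor
  · exact fun hq => by_contra fun hze =>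
      hq (encard_twistorLine_inter_iUnion_kerPlane hφ hinj he0 he hz hze)
  · intro hze
    have hsub : twistorProj ⁻¹' {twistorProj (.mk ℂ z hz)} ⊆ ⋃ i, kerPlane (φ i) :=
      (twistorLine_subset_kerPlane_iff.2 (fibre_eq_of_mem hz hze ▸ he ⟨0, hd⟩)).trans
        (Set.subset_iUnion (fun i => kerPlane (φ i)) _)
    rw [Disc, Set.mem_ofPred_eq, Set.inter_eq_left.2 hsub, (infinite_twistorLine hz).encard_eq]
    exact ENat.top_ne_natCast d

end DiscOfPlanes

section PlanesThroughTwistorLine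

/-- `X ⊆ ℂℙ³` is the union of `d` distinct planes containing a common twistor line. -/
def IsUnionOfPlanesThroughTwistorLine (d : ℕ) (X : Set CP3) : Prop :=
  ∃ H : Fin d → Set CP3, Function.Injective H ∧ (∀ i, IsPlane (H i)) ∧ X = ⋃ i, H i ∧
    ∃ L : Set CP3, IsTwistorLine L ∧ ∀ i, L ⊆ H i

variable {d : ℕ} {X : Set CP3}

theorem IsPlane.exists_twistorLine_subset (hX : IsPlane X) : ∃ L, IsTwistorLine L ∧ L ⊆ X := by
  obtain ⟨φ, -, rfl⟩ := isPlane_iff.1 hX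
  obtain ⟨e, he0, he⟩ := exists_fibre_le_ker φ
  exact ⟨_, ⟨twistorProj (.mk ℂ e he0), rfl⟩, twistorLine_subset_kerPlane_iff.2 he⟩

theorem IsPlane.isUnionOfPlanesThroughTwistorLine (hX : IsPlane X) :
    IsUnionOfPlanesThroughTwistorLine 1 X := by
  obtain ⟨L, hL, hLX⟩ := hX.exists_twistorLine_subset
  exact ⟨fun _ => X, Function.injective_of_subsingleton _, fun _ => hX, (Set.iUnion_const X).symm,
    L, hL, fun _ => hLX⟩

theorem IsUnionOfPlanesThroughTwistorLine.exists_disc_eq_singleton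
    (hX : IsUnionOfPlanesThroughTwistorLine d X) (hd : 1 ≤ d) : ∃ q, Disc d X = {q} := by
  obtain ⟨H, hinj, hH, rfl, _, ⟨q, rfl⟩, hL⟩ := hX
  choose φ hφ hHφ using fun i => isPlane_iff.1 (hH i)
  obtain rfl : H = fun i => kerPlane (φ i) := funext hHφ
  obtain ⟨e, he0, rfl⟩ := exists_twistorProj_mk_eq q
  exact ⟨_, disc_iUnion_kerPlane hd hφ (fun i k h => hinj (kerPlane_inj.2 h)) he0
    fun i => twistorLine_subset_kerPlane_iff.1 (hL i)⟩

theorem isUnionOfPlanesThroughTwistorLine_of_finite_disc {f : MvPolynomial (Fin 4) ℂ}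
    (hf : f.IsHomogeneous d) (hd : 1 ≤ d) (hfin : (Disc d (zeroLocus f)).Finite) :
    IsUnionOfPlanesThroughTwistorLine d (zeroLocus f) := by
  obtain ⟨φ, hφ, hinj, ⟨e, he0, he⟩, hφf⟩ := exists_planes_through_fibre hf hd hfin
  refine ⟨fun i => kerPlane (φ i), fun i k h => hinj (kerPlane_inj.1 h),
    fun i => isPlane_iff.2 ⟨φ i, hφ i, rfl⟩, ?_, _, ⟨twistorProj (.mk ℂ e he0), rfl⟩,
    fun i => twistorLine_subset_kerPlane_iff.2 (he i)⟩
  ext p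
  simp only [zeroLocus, kerPlane, Set.mem_iUnion, Set.mem_ofPred_eq, hφf, LinearMap.mem_ker]

end PlanesThroughTwistorLine

end Twistor

theorem proposition2p6 (d : ℕ) (hd : 1 ≤ d) (f : MvPolynomial (Fin 4) ℂ) (hf0 : f ≠ 0)
    (hf : f.IsHomogeneous d) :
    ((Twistor.Disc d (Twistor.zeroLocus f)).Finite ↔
      d = 1 ∨
      (1 < d ∧ ∃ H : Fin d → Set Twistor.CP3, Function.Injective H ∧
        (∀ i, Twistor.IsPlane (H i)) ∧ Twistor.zeroLocus f = ⋃ i, H i ∧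
        ∃ L : Set Twistor.CP3, Twistor.IsTwistorLine L ∧ ∀ i, L ⊆ H i)) ∧
    ((Twistor.Disc d (Twistor.zeroLocus f)).Finite →
      ∃ q : Twistor.HP1, Twistor.Disc d (Twistor.zeroLocus f) = {q}) := by
  have hplanes : (Twistor.Disc d (Twistor.zeroLocus f)).Finite →
      Twistor.IsUnionOfPlanesThroughTwistorLine d (Twistor.zeroLocus f) :=
    Twistor.isUnionOfPlanesThroughTwistorLine_of_finite_disc hf hd
  have hfinite (h : Twistor.IsUnionOfPlanesThroughTwistorLine d (Twistor.zeroLocus f)) :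
      (Twistor.Disc d (Twistor.zeroLocus f)).Finite := by
    obtain ⟨q, hq⟩ := h.exists_disc_eq_singleton hd
    exact hq ▸ Set.finite_singleton q
  refine ⟨⟨fun h => hd.eq_or_lt.imp Eq.symm fun hd1 => ⟨hd1, hplanes h⟩, ?_⟩,
    fun h => (hplanes h).exists_disc_eq_singleton hd⟩
  rintro (rfl | ⟨-, h⟩)
  · have hplane : Twistor.IsPlane (Twistor.zeroLocus f) := ⟨f, hf0, hf, rfl⟩
    exact hfinite hplane.isUnionOfPlanesThroughTwistorLine
  · exact hfinite h
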